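/- Let $k$ be a commutative ring and let $\mathbf{C}$ be a $k$-linear Grothendieck category. Let $\mathbf{a}\subset\mathbf{C}$ be an essentially small full additive subcategory such that (1) the objects of $\mathbf{a}$ generate $\mathbf{C}$, i.e. the functors $\mathbf{C}(A,-)$, $A\in\mathbf{a}$, are jointly faithful; (2) every object of $\mathbf{a}$ is compact in $\mathbf{C}$, i.e. $\mathbf{C}(A,-)$ commutes with filtered colimits; (3) every compact object of $\mathbf{C}$ is a subobject of an object of $\mathbf{a}$. **Definitions.** Write $\mathsf{PSh}\,\mathbf{a}$ for the category of $k$-linear functors $\mathbf{a}^{\mathrm{op}}\to\mathsf{Mod}_k$. A formal morphism $\amalg_\alpha A_\alpha\to\amalg_\beta B_\beta$ (over sets of objects of $\mathbf{a}$) is an element of $\prod_\alpha\bigoplus_\beta\mathbf{a}(A_\alpha,B_\beta)$, with matrix composition. A formal sequence is a pair of formal morphisms $\amalg_\gamma Z_\gamma\xrightarrow{p}\amalg_\beta Y_\beta\xrightarrow{q}X$ with $q\circ p=0$ and $X\in\mathbf{a}$. For a class $\mathcal{S}$ of formal sequences, $\mathcal{C}o(\mathcal{S})=\mathcal{C}o^1(\mathcal{S})$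 is the class of all $q$ occurring in $\mathcal{S}$, $\mathcal{C}o^0(\mathcal{S})$ is the class of identity morphisms of objects of $\mathbf{a}$, and for $i>1$ the class $\mathcal{C}o^i(\mathcal{S})$ consists of the composites $\amalg_\alpha\amalg_\delta W_\delta(\alpha)\to\amalg_\alpha V_\alpha\to X$ of an element $\amalg_\alpha V_\alpha\to X$ of $\mathcal{C}o^{i-1}(\mathcal{S})$ with elements $\amalg_\delta W_\delta(\alpha)\to V_\alpha$ of $\mathcal{C}o(\mathcal{S})$, one for each $\alpha$. Put $\widetilde{\mathcal{C}o}(\mathcal{S})=\bigcup_{i\ge0}\mathcal{C}o^i(\mathcal{S})$. The class $\mathcal{S}$ is a *pretopology* if * (PTa) for each $q:\amalg_\beta Y_\beta\to X$ in $\mathcal{C}o(\mathcal{S})$ and each $f:A\to X$ in $\mathbf{a}$ there are $q':\amalg_\delta C_\delta\to A$ in $\widetilde{\mathcal{C}o}(\mathcal{S})$ and a formal morphism $f':\amalg_\delta C_\delta\to\amalg_\beta Y_\beta$ with $q\circ f'=f\circ q'$; * (PTb) for each $(p,q)$ in $\mathcal{S}$ and each formal morphism $f:A\to\amalg_\beta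 Y_\beta$ with $A\in\mathbf{a}$ and $q\circ f=0$ there are $q':\amalg_\alpha B_\alpha\to A$ in $\widetilde{\mathcal{C}o}(\mathcal{S})$ and a formal morphism $f':\amalg_\alpha B_\alpha\to\amalg_\gamma Z_\gamma$ with $p\circ f'=f\circ q'$. A sieve on $A\in\mathbf{a}$ is a $k$-linear subfunctor of $\mathbf{a}(-,A)$; for $f:B\to A$, $f^{-1}R$ is the sieve of all $g$ with $f\circ g\in R$. A covering system $\mathcal{T}$ assigns to each $A\in\mathbf{a}$ a set $\mathcal{T}(A)$ of sieves on $A$; covering systems are ordered by inclusion. It is a ($k$-linear Grothendieck) *topology* if: $\mathbf{a}(-,A)\in\mathcal{T}(A)$; $R\in\mathcal{T}(A)$ implies $f^{-1}R\in\mathcal{T}(B)$ for all $f:B\to A$; and if $S$ is a sieve on $A$ and $R\in\mathcal{T}(A)$ is such that $f^{-1}S\in\mathcal{T}(B)$ for all $B$ and all $f\in R(B)$, then $S\in\mathcal{T}(A)$. A presheaf $F\in\mathsf{PSh}\,\mathbf{a}$ is a $\mathcal{T}$-sheaf if $\mathrm{Nat}(\mathbf{a}(-,A),F)\to\mathrm{Nat}(R,F)$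 is bijective for all $A$ and $R\in\mathcal{T}(A)$; $\mathsf{Sh}(\mathbf{a},\mathcal{T})\subset\mathsf{PSh}\,\mathbf{a}$ is the full subcategory of sheaves. A topology $\mathcal{T}$ is *subcanonical* if all $\mathbf{a}(-,X)$ are sheaves, and *noetherian* if the sheafification of each $\mathbf{a}(-,X)$ is a compact object of $\mathsf{Sh}(\mathbf{a},\mathcal{T})$. The *canonical noetherian* topology is the finest (largest) subcanonical noetherian topology. Finally, $\mathrm{top}(\mathcal{S})$ is the covering system of all sieves $R\subset\mathbf{a}(-,X)$ that contain the sieve generated by the components of some $r:\amalg_\alpha V_\alpha\to X$ in $\widetilde{\mathcal{C}o}(\mathcal{S})$. **Theorem.** Let $\mathcal{S}$ be the class of all right exact sequences $Z\to Y\to X$ in $\mathbf{a}$, i.e. those sequences of two morphisms of $\mathbf{a}$ for which $Y\to X$ is a cokernel in $\mathbf{a}$ of $Z\to Y$. Then: 1. $\mathcal{S}$ is a pretopology on $\mathbf{a}$. 2. $\mathrm{top}(\mathcal{S})$ is the canonical noetherian topology on $\mathbf{a}$; that is, $\mathrm{top}(\mathcal{S})$ is a subcanonical noetherian topology and contains every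 subcanonical noetherian topology on $\mathbf{a}$. 3. The functor $M\mapsto\mathbf{C}(-,M)|_{\mathbf{a}}$ is a $k$-linear equivalence from $\mathbf{C}$ to $\mathsf{Sh}(\mathbf{a},\mathrm{top}(\mathcal{S}))$, and also from $\mathbf{C}$ to the full subcategory of $\mathsf{PSh}\,\mathbf{a}$ of those $F$ for which the canonical morphism $F(\mathrm{coker} f)\to\ker F(f)$ is an isomorphism for every morphism $f$ of $\mathbf{a}$ which has a cokernel in $\mathbf{a}$. -/

import Mathlib

open CategoryTheory Limits Opposite
open scoped DirectSum

universe w v u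

noncomputable section

namespace LinearTop

/-! ## Linear presheaves, sieves and topologies -/

section Presheaves

variable (k : Type w) [CommRing k] (a : Type u) [Category.{v} a] [Preadditive a] [Linear k a]

/-- The `k`-linear functors `aᵒᵖ ⥤ Mod_k`, as a property of functors. -/
def IsLinearPresheaf : ObjectProperty (aᵒᵖ ⥤ ModuleCat.{v} k) := fun F =>
  F.Additive ∧ ∀ ⦃X Y : a⦄ (r : k) (f : X ⟶ Y), F.map (r • f).op = r • F.map f.op

variable {a}

/-- A `k`-linear sieve on `A`: a `k`-linear subfunctor of `a(-, A)`. -/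
@[ext]
structure LinearSieve (A : a) where
  /-- the submodule of `a(B, A)` -/
  arrows : ∀ B : a, Submodule k (B ⟶ A)
  precomp_mem : ∀ ⦃B C : a⦄ (g : C ⟶ B) (f : B ⟶ A), f ∈ arrows B → g ≫ f ∈ arrows C

namespace LinearSieve

variable {k}

instance (A : a) : LE (LinearSieve k A) := ⟨fun R S => ∀ B : a, R.arrows B ≤ S.arrows B⟩

/-- The maximal sieve `a(-, A)` on `A`. -/
def maximal (A : a) : LinearSieve k A where
  arrows _ := ⊤
  precomp_mem _ _ _ _ _ := Submodule.mem_top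

/-- The sieve `f⁻¹ R` on `B`, consisting of the `g` with `f ∘ g ∈ R`. -/
def pullback {A B : a} (f : B ⟶ A) (R : LinearSieve k A) : LinearSieve k B where
  arrows C := (R.arrows C).comap (Linear.rightComp k C f)
  precomp_mem C D g h hh := by
    have := R.precomp_mem g (h ≫ f) hh
    simpa [Submodule.mem_comap] using this

/-- The sieve seen as a presheaf. -/
def toFunctor {A : a} (R : LinearSieve k A) : aᵒᵖ ⥤ ModuleCat.{v} k where
  obj B := ModuleCat.of k (R.arrows B.unop)
  map {B C} g := ModuleCat.ofHom
    ((Linear.leftComp k A g.unop).restrict fun f hf => R.precomp_mem g.unop f hf)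
  map_id B := by ext f; exact Category.id_comp _
  map_comp g h := by ext f; exact Category.assoc _ _ _

/-- The inclusion of a sieve on `A` into the representable presheaf `a(-, A)`. -/
def incl {A : a} (R : LinearSieve k A) : R.toFunctor ⟶ (linearYoneda k a).obj A where
  app B := ModuleCat.ofHom (R.arrows B.unop).subtype

end LinearSieve

variable (a)

/-- A covering system: a set of sieves on every object; ordered by inclusion. -/
abbrev CoveringSystem := ∀ A : a, Set (LinearSieve k A)

variable {k a}

/-- `k`-linear Grothendieck topologies. -/
structure IsTopology (T : CoveringSystem k a) : Prop where
  maximal_mem : ∀ A : a, LinearSieve.maximal A ∈ T A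
  pullback_mem : ∀ ⦃A B : a⦄ (f : B ⟶ A) (R : LinearSieve k A), R ∈ T A → R.pullback f ∈ T B
  local_mem : ∀ ⦃A : a⦄ (S R : LinearSieve k A), R ∈ T A →
    (∀ (B : a) (f : B ⟶ A), f ∈ R.arrows B → S.pullback f ∈ T B) → S ∈ T A

/-- `F` is a sheaf for `T`: it is a `k`-linear presheaf, and
`Nat(a(-, A), F) → Nat(R, F)` is bijective for every covering sieve `R` on `A`. -/
def IsSheaf (T : CoveringSystem k a) : ObjectProperty (aᵒᵖ ⥤ ModuleCat.{v} k) := fun F =>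
  IsLinearPresheaf k a F ∧ ∀ (A : a) (R : LinearSieve k A), R ∈ T A →
    Function.Bijective (fun φ : (linearYoneda k a).obj A ⟶ F => R.incl ≫ φ)

/-- The category `Sh(a, T)` of sheaves. -/
abbrev Sh (T : CoveringSystem k a) := (IsSheaf T).FullSubcategory

/-- Every representable presheaf is a sheaf. -/
def IsSubcanonical (T : CoveringSystem k a) : Prop :=
  ∀ X : a, IsSheaf T ((linearYoneda k a).obj X)

/-- `Z` is the sheafification of the representable presheaf `a(-, X)`, that is, the value of the
left adjoint of the inclusion of sheaves into presheaves: `Sh(a, T)(Z, F) ≃ Nat(a(-, X), F)`,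
naturally in the sheaf `F`. -/
def IsSheafifiedRepresentable (T : CoveringSystem k a) (X : a) (Z : Sh T) : Prop :=
  Nonempty (((IsSheaf T).ι ⋙ coyoneda.obj (op ((linearYoneda k a).obj X))).CorepresentableBy Z)

/-- The sheafification of every representable presheaf is a compact object of `Sh(a, T)`. -/
def IsNoetherian (T : CoveringSystem k a) : Prop :=
  ∀ X : a, ∃ Z : Sh T, IsSheafifiedRepresentable T X Z ∧ IsFinitelyPresentable.{v} Z

/-- `T` is the canonical noetherian topology: the finest subcanonical noetherian topology. -/
def IsCanonicalNoetherian (T : CoveringSystem k a) : Prop :=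
  IsGreatest {T' : CoveringSystem k a | IsTopology T' ∧ IsSubcanonical T' ∧ IsNoetherian T'} T

end Presheaves

/-! ## Formal sequences and pretopologies -/

section Pretopologies

/-- A formal coproduct `∐ᵢ Aᵢ` of objects of `a`. -/
structure FormalCoprod (a : Type u) where
  ι : Type v
  obj : ι → a

variable {a : Type u} [Category.{v} a]

/-- A formal morphism `∐ᵢ Vᵢ → X` to an object `X`. -/
structure FormalCover (X : a) where
  dom : FormalCoprod.{v} a
  hom : ∀ i, dom.obj i ⟶ X

/-- The identity of `X` as a formal morphism. -/
def FormalCover.id (X : a) : FormalCover X := ⟨⟨PUnit, fun _ => X⟩, fun _ => 𝟙 X⟩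

/-- The formal morphism `∐ᵢ ∐ⱼ Wⱼ(i) → X` composed of `v : ∐ᵢ Vᵢ → X` and
`w(i) : ∐ⱼ Wⱼ(i) → Vᵢ`. -/
def FormalCover.comp {X : a} (v : FormalCover X) (w : ∀ i, FormalCover (v.dom.obj i)) :
    FormalCover X :=
  ⟨⟨Σ i, (w i).dom.ι, fun x => (w x.1).dom.obj x.2⟩, fun x => (w x.1).hom x.2 ≫ v.hom x.1⟩

variable [Preadditive a]

/-- Formal morphisms `A → ∐ⱼ Bⱼ` from an object `A`: elements of `⨁ⱼ a(A, Bⱼ)`. -/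
abbrev FormalElt (A : a) (B : FormalCoprod.{v} a) := ⨁ j : B.ι, (A ⟶ B.obj j)

/-- Formal morphisms `∐ᵢ Aᵢ → ∐ⱼ Bⱼ`: elements of `∏ᵢ ⨁ⱼ a(Aᵢ, Bⱼ)`. -/
abbrev FormalHom (A B : FormalCoprod.{v} a) := ∀ i : A.ι, FormalElt (A.obj i) B

/-- A formal sequence `∐ Z_γ → ∐ Y_β → X` with zero composite, ending in `X`.
All sums are finite, since an element of a direct sum has finite support. -/
structure FormalSeq (X : a) where
  Z : FormalCoprod.{v} a
  q : FormalCover X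
  p : FormalHom Z q.dom
  zero : ∀ γ : Z.ι, ∑ᶠ β, p γ β ≫ q.hom β = 0

/-- An ordinary sequence `Z → Y → X` as a formal sequence. -/
def FormalSeq.ofPair {Z Y X : a} (p : Z ⟶ Y) (q : Y ⟶ X) (h : p ≫ q = 0) : FormalSeq X where
  Z := ⟨PUnit, fun _ => Z⟩
  q := ⟨⟨PUnit, fun _ => Y⟩, fun _ => q⟩
  p := fun _ => DirectSum.of (fun _ : PUnit => (Z ⟶ Y)) PUnit.unit p
  zero := fun γ => by
    have e : (DirectSum.of (fun _ : PUnit.{v + 1} => (Z ⟶ Y)) PUnit.unit p) PUnit.unit = p :=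
      DirectSum.of_eq_same _ _
    rw [finsum_unique]
    exact (congrArg (· ≫ q) e).trans h

variable (a)

/-- A class of formal sequences. -/
abbrev SeqClass := ∀ X : a, Set (FormalSeq X)

variable {a}

/-- The formal morphisms with target `X` on the right of the sequences in `S`. -/
def Co (S : SeqClass a) (X : a) : Set (FormalCover X) := {q | ∃ s ∈ S X, s.q = q}

/-- The iterated classes: `0` gives identities, `1` gives `Co S`, and the elements of the next
class are the composites of an element of the previous class with elements of `Co S`. -/
def CoIter (S : SeqClass a) : ℕ → ∀ X : a, Set (FormalCover X)
  | 0, X => {FormalCover.id X}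
  | 1, X => Co S X
  | n + 2, X => {r | ∃ v ∈ CoIter S (n + 1) X, ∃ w : ∀ i, FormalCover (v.dom.obj i),
      (∀ i, w i ∈ Co S (v.dom.obj i)) ∧ r = v.comp w}

/-- The union of the classes `CoIter S n`, for all `n ≥ 0`. -/
def CoTilde (S : SeqClass a) (X : a) : Set (FormalCover X) := {r | ∃ n, r ∈ CoIter S n X}

/-- Additive Grothendieck pretopologies (the conditions do not involve `k`). -/
structure IsPretopology (S : SeqClass a) : Prop where
  /-- for `q : ∐ Y_β → X` in `Co S` and `f : A → X` there are `q' : ∐ C_δ → A` in `CoTilde S` and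
  `f' : ∐ C_δ → ∐ Y_β` with `q ∘ f' = f ∘ q'` -/
  pta : ∀ ⦃X A : a⦄ (q : FormalCover X), q ∈ Co S X → ∀ f : A ⟶ X,
    ∃ q' ∈ CoTilde S A, ∃ f' : FormalHom q'.dom q.dom,
      ∀ δ, ∑ᶠ β, f' δ β ≫ q.hom β = q'.hom δ ≫ f
  /-- for `(p, q)` in `S` and `f : A → ∐ Y_β` with `q ∘ f = 0` there are `q' : ∐ B_α → A` in
  `CoTilde S` and `f' : ∐ B_α → ∐ Z_γ` with `p ∘ f' = f ∘ q'` -/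
  ptb : ∀ ⦃X A : a⦄ (s : FormalSeq X), s ∈ S X → ∀ f : FormalElt A s.q.dom,
    ∑ᶠ β, f β ≫ s.q.hom β = 0 →
    ∃ q' ∈ CoTilde S A, ∃ f' : FormalHom q'.dom s.Z,
      ∀ α β, ∑ᶠ γ, f' α γ ≫ s.p γ β = q'.hom α ≫ f β

variable (a) in
/-- The class of all right exact sequences `Z → Y → X` in `a`, that is, those for which
`Y → X` is a cokernel of `Z → Y`. -/
def rightExactSeqs : SeqClass a := fun X =>
  {s | ∃ (Z Y : a) (p : Z ⟶ Y) (q : Y ⟶ X) (h : p ≫ q = 0),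
    Nonempty (IsColimit (CokernelCofork.ofπ q h)) ∧ s = FormalSeq.ofPair p q h}

end Pretopologies

section Generated

variable {k : Type w} [CommRing k] {a : Type u} [Category.{v} a] [Preadditive a] [Linear k a]

variable (k) in
/-- The `k`-linear sieve on `X` generated by the components `r i` of a formal morphism `r`. -/
def FormalCover.sieve {X : a} (r : FormalCover X) : LinearSieve k X where
  arrows B := ⨆ i, LinearMap.range (Linear.rightComp k B (r.hom i))
  precomp_mem B C g f hf := by
    have hle : (⨆ i, LinearMap.range (Linear.rightComp k B (r.hom i))) ≤
        (⨆ i, LinearMap.range (Linear.rightComp k C (r.hom i))).comap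
          (Linear.leftComp k X g) := by
      refine iSup_le fun i => ?_
      rintro _ ⟨h, rfl⟩
      refine Submodule.mem_iSup_of_mem i ⟨g ≫ h, ?_⟩
      simp
    exact hle hf

variable (k) in
/-- The covering system `top(S)`: all sieves on `X` which contain the sieve generated by some
element of `CoTilde S X`. -/
def top (S : SeqClass a) : CoveringSystem k a := fun X =>
  {R | ∃ r ∈ CoTilde S X, r.sieve k ≤ R}

variable (k a) in
/-- The `k`-linear functors `F : aᵒᵖ ⥤ Mod_k` for which the canonical morphism
`F(coker f) → ker F(f)` is an isomorphism, for every morphism `f` which has a cokernel. -/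
def SendsCokernelsToKernels : ObjectProperty (aᵒᵖ ⥤ ModuleCat.{v} k) := fun F =>
  IsLinearPresheaf k a F ∧ ∀ ⦃Z Y : a⦄ (f : Z ⟶ Y) [HasCokernel f],
    ∃ h : F.map (cokernel.π f).op ≫ F.map f.op = 0,
      IsIso (kernel.lift (F.map f.op) (F.map (cokernel.π f).op) h)

end Generated

/-- The functor `M ↦ C(-, M)|_P` from `C` to presheaves on the full subcategory `P`. -/
abbrev restrictedYoneda (k : Type w) [CommRing k] {C : Type u} [Category.{v} C] [Preadditive C]
    [Linear k C] (P : ObjectProperty C) :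
    C ⥤ P.FullSubcategoryᵒᵖ ⥤ ModuleCat.{v} k :=
  linearYoneda k C ⋙ (Functor.whiskeringLeft _ _ _).obj P.ι.op

end LinearTop

end

noncomputable section

/-! Write `a` for the full subcategory given by `P`. Everything rests on one comparison: a morphism
of `a` is a cokernel in `a` exactly when it is an epimorphism of `C`. A cokernel in `C` of a
morphism of `a` is compact, so it embeds into an object of `a`, and the universal property in `a`
therefore controls it (`epi_hom`, `exact_of_isColimit`). Conversely, an epimorphism `Y ⟶ X` of `C`
is the cokernel of its kernel; the kernel is covered by objects of `a`, and compactness of `X` and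
`Y` leaves a finite family, whose biproduct lies in `a` (`exists_isColimit_of_epi`).

Hence a sieve is in `top` iff it contains an epimorphism of `C` (`mem_top_iff`). Such epimorphisms
compose, and any morphism from an object of `a` to the target of an epimorphism lifts after
refinement by one of them (`exists_lift`). This gives the pretopology and topology axioms, and
identifies sheaves with the linear functors turning cokernels into kernels. Such a functor `F` is a
quotient of some `C(-, N)`, with `N` a coproduct of objects of `a`. Dividing `N` by all morphisms
from `a` that die in `F` gives an object representing `F`.

For maximality, let `R` cover `X` in a subcanonical noetherian topology. For each finite part `s` of
`R`, form the sheaf image of `a(-, X)` in the product of representables indexed by all `X ⟶ A`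
killed by `s`. These sheaves have colimit zero because `R` covers. The sheafification of `a(-, X)`
is compact, so for some `s` every `X ⟶ A` killed by `s` is zero. The sum of the members of this `s`
is then an epimorphism of `C` lying in `R`. -/

namespace LinearTop

/-! ### Compactness and finite subfamilies. -/

section FiniteFamilies

variable {C : Type u} [Category.{v} C] [Abelian C] [HasColimitsOfSize.{v, v} C]
  {J : Type v} {A : J → C} {Y : C} (f : ∀ j, A j ⟶ Y)

/-- The quotients of `Y` by the images of finitely many members of a family of morphisms to `Y`. -/
def finiteQuotients : Finset J ⥤ C where
  obj s := cokernel (Sigma.desc fun j : s => f j)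
  map {s t} h := cokernel.desc _ (cokernel.π (Sigma.desc fun j : t => f j)) (by
    ext ⟨j, hj⟩
    have : f j = Sigma.ι (fun j : t => A j) ⟨j, leOfHom h hj⟩ ≫ Sigma.desc fun j : t => f j := by
      simp
    simp only [Sigma.ι_desc_assoc, comp_zero]
    rw [this, Category.assoc, cokernel.condition, comp_zero])

/-- The projection of `Y` to its quotient. -/
def finiteQuotientsπ (s : Finset J) : Y ⟶ (finiteQuotients f).obj s :=
  cokernel.π (Sigma.desc fun j : s => f j)

lemma finiteQuotientsπ_map {s t : Finset J} (h : s ⟶ t) :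
    finiteQuotientsπ f s ≫ (finiteQuotients f).map h = finiteQuotientsπ f t :=
  cokernel.π_desc _ _ _

lemma comp_finiteQuotientsπ {s : Finset J} {j : J} (hj : j ∈ s) :
    f j ≫ finiteQuotientsπ f s = 0 := by
  have : f j = Sigma.ι (fun j : s => A j) ⟨j, hj⟩ ≫ Sigma.desc fun j : s => f j := by simp
  rw [this, Category.assoc]
  exact (congrArg _ (cokernel.condition _)).trans comp_zero

lemma exists_finiteQuotientsπ_comp {s : Finset J} {T : C} (t : Y ⟶ T)
    (ht : ∀ j ∈ s, f j ≫ t = 0) :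
    ∃ t' : (finiteQuotients f).obj s ⟶ T, finiteQuotientsπ f s ≫ t' = t :=
  ⟨cokernel.desc _ t (by ext ⟨j, hj⟩; simpa using ht j hj), cokernel.π_desc _ _ _⟩

lemma finiteQuotientsπ_colimit_ι (s : Finset J) :
    finiteQuotientsπ f s ≫ colimit.ι (finiteQuotients f) s =
      finiteQuotientsπ f ∅ ≫ colimit.ι (finiteQuotients f) ∅ := by
  rw [← finiteQuotientsπ_map f (homOfLE (Finset.empty_subset s)), Category.assoc, colimit.w]

lemma comp_finiteQuotientsπ_colimit_ι (s : Finset J) (j : J) :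
    f j ≫ finiteQuotientsπ f s ≫ colimit.ι (finiteQuotients f) s = 0 := by
  rw [finiteQuotientsπ_colimit_ι, ← finiteQuotientsπ_colimit_ι f {j}, ← Category.assoc,
    comp_finiteQuotientsπ f (Finset.mem_singleton_self j), zero_comp]

/-- A morphism from a compact object which is killed by every morphism killing a family is killed
by every morphism killing a suitable finite subfamily. -/
theorem exists_finset_comp_eq_zero {B : C} [IsFinitelyPresentable.{v} B] (h : B ⟶ Y)
    (hh : ∀ ⦃T : C⦄ (t : Y ⟶ T), (∀ j, f j ≫ t = 0) → h ≫ t = 0) :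
    ∃ s : Finset J, ∀ ⦃T : C⦄ (t : Y ⟶ T), (∀ j ∈ s, f j ≫ t = 0) → h ≫ t = 0 := by
  -- In the filtered colimit of the finite quotients every `f j` dies, hence so does `h`;
  -- compactness of `B` makes it die at a finite stage.
  have e := hh _ (comp_finiteQuotientsπ_colimit_ι f ∅)
  obtain ⟨s, u, u', hu⟩ := IsFinitelyPresentable.exists_eq_of_isColimit
    (colimit.isColimit (finiteQuotients f)) (h ≫ finiteQuotientsπ f ∅)
    (0 : B ⟶ (finiteQuotients f).obj ∅) (by simpa using e)
  refine ⟨s, fun T t ht => ?_⟩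
  obtain ⟨t', rfl⟩ := exists_finiteQuotientsπ_comp f t ht
  rw [zero_comp, Category.assoc, finiteQuotientsπ_map] at hu
  rw [reassoc_of% hu, zero_comp]

/-- A morphism of compact objects which is a joint cokernel of a family is a joint cokernel of a
finite subfamily. -/
theorem exists_finset_factors {X : C} [IsFinitelyPresentable.{v} X] [IsFinitelyPresentable.{v} Y]
    (q : Y ⟶ X)
    (hq : ∀ ⦃T : C⦄ (t : Y ⟶ T), (∀ j, f j ≫ t = 0) → ∃ t' : X ⟶ T, q ≫ t' = t) :
    ∃ s : Finset J, ∀ ⦃T : C⦄ (t : Y ⟶ T), (∀ j ∈ s, f j ≫ t = 0) →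
      ∃ t' : X ⟶ T, q ≫ t' = t := by
  -- The colimit is the quotient by the whole family, so it receives a map from `X`. Compactness of
  -- `X` lifts this map to a finite stage; compactness of `Y` makes the triangle with `q` commute at
  -- a later one.
  obtain ⟨g, hg⟩ := hq _ (comp_finiteQuotientsπ_colimit_ι f ∅)
  obtain ⟨s, g', hg'⟩ := IsFinitelyPresentable.exists_hom_of_isColimit
    (colimit.isColimit (finiteQuotients f)) g
  dsimp at hg'
  obtain ⟨s', u, u', hu⟩ := IsFinitelyPresentable.exists_eq_of_isColimit
    (colimit.isColimit (finiteQuotients f)) (q ≫ g') (finiteQuotientsπ f s) (by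
      simp only [colimit.cocone_ι, Category.assoc]
      rw [hg', hg, finiteQuotientsπ_colimit_ι f s])
  refine ⟨s', fun T t ht => ?_⟩
  obtain ⟨t', rfl⟩ := exists_finiteQuotientsπ_comp f t ht
  rw [finiteQuotientsπ_map] at hu
  exact ⟨g' ≫ (finiteQuotients f).map u ≫ t', by simpa using hu =≫ t'⟩

/-- The projection of a coproduct to a summand. -/
def sigmaProj (A : J → C) (i : J) : ∐ A ⟶ A i :=
  open Classical in
  Sigma.desc fun j => if h : j = i then eqToHom (by rw [h]) else 0

@[simp]
lemma ι_sigmaProj_self (A : J → C) (i : J) : Sigma.ι A i ≫ sigmaProj A i = 𝟙 _ := by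
  simp [sigmaProj]

lemma ι_sigmaProj_of_ne (A : J → C) {i j : J} (h : j ≠ i) :
    Sigma.ι A j ≫ sigmaProj A i = 0 := by
  simp [sigmaProj, h]

/-- A morphism from a compact object to a coproduct factors through a finite subcoproduct. -/
theorem exists_finset_eq_sum {B : C} [IsFinitelyPresentable.{v} B] (b : B ⟶ ∐ A) :
    ∃ s : Finset J, b = ∑ j ∈ s, b ≫ sigmaProj A j ≫ Sigma.ι A j := by
  obtain ⟨s, hs⟩ := exists_finset_comp_eq_zero (Sigma.ι A) b fun T t ht => by
    have : t = 0 := by ext j; simpa using ht j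
    rw [this, comp_zero]
  refine ⟨s, ?_⟩
  -- The identity minus the projector onto the summands in `s` kills every inclusion indexed by `s`,
  -- so it kills `b`.
  have := hs (𝟙 _ - ∑ j ∈ s, sigmaProj A j ≫ Sigma.ι A j) fun i hi => by
    rw [Preadditive.comp_sub, Preadditive.comp_sum, Finset.sum_eq_single i]
    · rw [← Category.assoc, ι_sigmaProj_self, Category.comp_id, Category.id_comp, sub_self]
    · intro j _ hj
      rw [← Category.assoc, ι_sigmaProj_of_ne A hj.symm, zero_comp]
    · exact fun h => (h hi).elim
  rwa [Preadditive.comp_sub, Category.comp_id, Preadditive.comp_sum, sub_eq_zero] at this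

lemma finite_comp_sigmaProj_ne_zero {B : C} [IsFinitelyPresentable.{v} B] (b : B ⟶ ∐ A) :
    {j | b ≫ sigmaProj A j ≠ 0}.Finite := by
  obtain ⟨s, hs⟩ := exists_finset_eq_sum b
  refine s.finite_toSet.subset fun i hi => ?_
  by_contra hi'
  refine hi ?_
  rw [hs, Preadditive.sum_comp]
  refine Finset.sum_eq_zero fun j hj => ?_
  have : j ≠ i := fun h => hi' (h ▸ hj)
  simp [ι_sigmaProj_of_ne A this]

end FiniteFamilies

lemma isFinitelyPresentable_cokernel {C : Type u} [Category.{v} C] [Abelian C]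
    [HasColimitsOfSize.{v, v} C] {X Y : C} (f : X ⟶ Y) [IsFinitelyPresentable.{v} X]
    [IsFinitelyPresentable.{v} Y] : IsFinitelyPresentable.{v} (cokernel f) := by
  have : Fact (Cardinal.aleph0.{v}).IsRegular := Cardinal.fact_isRegular_aleph0
  have (k : WalkingParallelPair) :
      IsCardinalPresentable ((parallelPair f 0).obj k) Cardinal.aleph0.{v} := by
    rcases k with _ | _ <;> dsimp <;> infer_instance
  exact isCardinalPresentable_of_isColimit _ (colimit.isColimit (parallelPair f 0)) Cardinal.aleph0.{v}
    (hasCardinalLT_of_finite _ _ le_rfl)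

/-! ### Representatives and finite biproducts in the generating subcategory. -/

/-- The essentially small full subcategory given by `P` consists of compact generators, and every
compact object embeds into one of its objects. -/
structure IsEmbeddingGenerator {C : Type u} [Category.{v} C] (P : ObjectProperty C) : Prop where
  generator : P.IsSeparating
  compact : ∀ A : C, P A → IsFinitelyPresentable.{v} A
  subobject : ∀ V : C, IsFinitelyPresentable.{v} V → ∃ (A : C) (i : V ⟶ A), P A ∧ Mono i

/-- The objects of a small set of representatives of an essentially small category. -/
def representative {a : Type u} [Category.{v} a] [EssentiallySmall.{v} a]
    (B : SmallModel.{v} a) : a :=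
  (equivSmallModel a).inverse.obj B

lemma exists_iso_representative {a : Type u} [Category.{v} a] [EssentiallySmall.{v} a] (A : a) :
    ∃ B, Nonempty (A ≅ representative B) :=
  ⟨_, ⟨(equivSmallModel a).unitIso.app A⟩⟩

section

variable {C : Type u} [Category.{v} C] {P : ObjectProperty C}
  [EssentiallySmall.{v} P.FullSubcategory]

variable (P) in
/-- The morphisms from representatives to an object. -/
abbrev MapsTo (W : C) : Type v :=
  Σ B : SmallModel.{v} P.FullSubcategory, (representative B).obj ⟶ W

variable [Abelian C]

/-- Restricting the separating family to representatives keeps the index type in `Type v`, where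
coproducts exist. -/
lemma IsEmbeddingGenerator.eq_zero (hP : IsEmbeddingGenerator P) {W T : C} (t : W ⟶ T)
    (ht : ∀ j : MapsTo P W, j.2 ≫ t = 0) : t = 0 := by
  refine hP.generator t 0 fun G hG h => ?_
  obtain ⟨B, ⟨e⟩⟩ := exists_iso_representative (⟨G, hG⟩ : P.FullSubcategory)
  have h1 : h = e.hom.hom ≫ e.inv.hom ≫ h := by simp
  have h2 := ht ⟨B, e.inv.hom ≫ h⟩
  rw [h1, Category.assoc, h2, comp_zero, comp_zero]

end

section

variable {C : Type u} [Category.{v} C] [Abelian C] {P : ObjectProperty C}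
  [HasFiniteBiproducts P.FullSubcategory] {J : Type v} (A : J → P.FullSubcategory)
  {Y : C} (f : ∀ j, (A j).obj ⟶ Y) (s : Finset J)

/-- The morphism from a finite biproduct in a full subcategory given by its components. -/
def biproductDesc : (⨁ fun j : s => A j).obj ⟶ Y :=
  ∑ j : s, (biproduct.π (fun j : s => A j) j).hom ≫ f j

lemma ι_biproductDesc {j : J} (hj : j ∈ s) :
    (biproduct.ι (fun j : s => A j) ⟨j, hj⟩).hom ≫ biproductDesc A f s = f j := by
  rw [biproductDesc, Preadditive.comp_sum, Finset.sum_eq_single ⟨j, hj⟩]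
  · rw [← Category.assoc, ← ObjectProperty.FullSubcategory.comp_hom, biproduct.ι_π_self]
    simp
  · intro i _ hi
    rw [← Category.assoc, ← ObjectProperty.FullSubcategory.comp_hom, biproduct.ι_π_ne _ hi.symm]
    exact zero_comp
  · exact fun h => (h (Finset.mem_univ _)).elim

lemma biproductDesc_comp {T : C} (t : Y ⟶ T) :
    biproductDesc A f s ≫ t = biproductDesc A (fun j => f j ≫ t) s := by
  simp [biproductDesc, Preadditive.sum_comp]

variable {A f s} in
lemma comp_eq_zero_of_biproductDesc_comp {T : C} {t : Y ⟶ T} (ht : biproductDesc A f s ≫ t = 0)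
    {j : J} (hj : j ∈ s) : f j ≫ t = 0 := by
  rw [← ι_biproductDesc A f s hj, Category.assoc, ht, comp_zero]

end

/-! ### Cokernels in the subcategory and epimorphisms of the ambient category. -/

namespace IsEmbeddingGenerator

variable {C : Type u} [Category.{v} C] [Abelian C] [IsGrothendieckAbelian.{v} C]
  {P : ObjectProperty C} (hP : IsEmbeddingGenerator P)
include hP

/-- The cokernel of `q` in `C` is compact, so it embeds into an object of the subcategory, where the
hypothesis shows that the projection vanishes. -/
lemma epi_hom {Y X : P.FullSubcategory} (q : Y ⟶ X)
    (hq : ∀ (A : P.FullSubcategory) (g : X ⟶ A), q ≫ g = 0 → g = 0) : Epi q.hom := by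
  have := hP.compact _ X.property
  have := hP.compact _ Y.property
  obtain ⟨A, i, hA, _⟩ := hP.subobject _ (isFinitelyPresentable_cokernel q.hom)
  have := hq ⟨A, hA⟩ (ObjectProperty.homMk (cokernel.π q.hom ≫ i)) (by
    ext
    change q.hom ≫ cokernel.π q.hom ≫ i = 0
    rw [cokernel.condition_assoc, zero_comp])
  have h0 : cokernel.π q.hom ≫ i = 0 := congrArg InducedCategory.Hom.hom this
  exact Preadditive.epi_of_cokernel_zero (zero_of_comp_mono i h0)

/-- Cokernels in the subcategory are cokernels in the ambient category. -/
lemma exact_of_isColimit {Z Y X : P.FullSubcategory} (p : Z ⟶ Y) (q : Y ⟶ X) (h : p ≫ q = 0)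
    (hq : IsColimit (CokernelCofork.ofπ q h)) :
    Epi q.hom ∧ (ShortComplex.mk p.hom q.hom (congrArg InducedCategory.Hom.hom h)).Exact := by
  have hepi : Epi q.hom := hP.epi_hom q fun A g hg =>
    Cofork.IsColimit.hom_ext hq (hg.trans comp_zero.symm)
  refine ⟨hepi, ?_⟩
  have h' : p.hom ≫ q.hom = 0 := congrArg InducedCategory.Hom.hom h
  have := hP.compact _ Z.property
  have := hP.compact _ Y.property
  obtain ⟨A, i, hA, _⟩ := hP.subobject _ (isFinitelyPresentable_cokernel p.hom)
  let q' := cokernel.desc p.hom q.hom h'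
  have hqq : cokernel.π p.hom ≫ q' = q.hom := cokernel.π_desc _ _ _
  -- Since `q` is a cokernel in the subcategory, `Y ⟶ coker p ⟶ A` factors through `X`. The
  -- comparison `q'` is then the first factor of the monomorphism `i`, hence an isomorphism.
  obtain ⟨x, hx⟩ := CokernelCofork.IsColimit.desc' hq
    (ObjectProperty.homMk (cokernel.π p.hom ≫ i) : Y ⟶ ⟨A, hA⟩) (by
      ext
      change p.hom ≫ cokernel.π p.hom ≫ i = 0
      rw [cokernel.condition_assoc, zero_comp])
  have hx' : q.hom ≫ x.hom = cokernel.π p.hom ≫ i := congrArg InducedCategory.Hom.hom hx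
  have h1 : q' ≫ x.hom = i := by
    rw [← cancel_epi (cokernel.π p.hom), ← Category.assoc, hqq, hx']
  have : Mono (q' ≫ x.hom) := h1 ▸ inferInstance
  have : Mono q' := mono_of_mono q' x.hom
  have : Epi (cokernel.π p.hom ≫ q') := hqq ▸ hepi
  have : Epi q' := epi_of_epi (cokernel.π p.hom) q'
  have : IsIso q' := isIso_of_mono_of_epi q'
  exact ShortComplex.exact_of_g_is_cokernel _
    (IsColimit.ofIsoColimit (cokernelIsCokernel p.hom) (Cofork.ext (asIso q') hqq))

variable [EssentiallySmall.{v} P.FullSubcategory] [HasFiniteBiproducts P.FullSubcategory]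

/-- The pullback of `q` is an epimorphism onto `A`, and its source is covered by objects of the
subcategory. Since `A` is compact, finitely many of them already cover `A`, and their biproduct
serves as `A'`. -/
lemma exists_lift {N M : C} (q : N ⟶ M) [Epi q] (A : P.FullSubcategory) (f : A.obj ⟶ M) :
    ∃ (A' : P.FullSubcategory) (c : A' ⟶ A) (n : A'.obj ⟶ N),
      Epi c.hom ∧ n ≫ q = c.hom ≫ f := by
  have := hP.compact _ A.property
  let g (j : MapsTo P (pullback q f)) := j.2 ≫ pullback.snd q f
  obtain ⟨s, hs⟩ := exists_finset_comp_eq_zero g (𝟙 A.obj) fun T t ht => by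
    have := hP.eq_zero (pullback.snd q f ≫ t) fun j => by simpa [g] using ht j
    rw [zero_of_epi_comp _ this, comp_zero]
  refine ⟨⨁ fun j : s => representative j.1.1, ObjectProperty.homMk (biproductDesc _ g s),
    biproductDesc _ (fun j => j.2 ≫ pullback.fst q f) s, ?_, ?_⟩
  · refine Preadditive.epi_of_cancel_zero _ fun {T} t ht => ?_
    rw [← Category.id_comp t]
    exact hs t fun j hj => comp_eq_zero_of_biproductDesc_comp ht hj
  · change _ = biproductDesc _ g s ≫ f
    simp [biproductDesc_comp, g, pullback.condition]

/-- `q` is the cokernel in `C` of its kernel, and `exists_finset_factors` replaces a covering of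
this kernel by a finite family. Its biproduct is `Z`. -/
lemma exists_isColimit_of_epi {Y X : P.FullSubcategory} (q : Y ⟶ X) [Epi q.hom] :
    ∃ (Z : P.FullSubcategory) (p : Z ⟶ Y) (h : p ≫ q = 0),
      Nonempty (IsColimit (CokernelCofork.ofπ q h)) := by
  have := hP.compact _ X.property
  have := hP.compact _ Y.property
  let g (j : MapsTo P (kernel q.hom)) := j.2 ≫ kernel.ι q.hom
  obtain ⟨s, hs⟩ := exists_finset_factors g q.hom fun T t ht => by
    have := hP.eq_zero (kernel.ι q.hom ≫ t) fun j => by simpa [g] using ht j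
    obtain ⟨t', ht'⟩ := CokernelCofork.IsColimit.desc'
      (Abelian.epiIsCokernelOfKernel _ (kernelIsKernel q.hom)) t this
    exact ⟨t', ht'⟩
  have hpq : biproductDesc _ g s ≫ q.hom = 0 := by
    simp [biproductDesc, Preadditive.sum_comp, g]
  refine ⟨⨁ fun j : s => representative j.1.1, ObjectProperty.homMk (biproductDesc _ g s),
    by ext; exact hpq, ⟨?_⟩⟩
  have key : ∀ {T : P.FullSubcategory} (t : Y ⟶ T),
      ObjectProperty.homMk (biproductDesc _ g s) ≫ t = 0 → ∃ t' : X ⟶ T, q ≫ t' = t := by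
    intro T t ht
    have ht0 : biproductDesc _ g s ≫ t.hom = 0 := congrArg InducedCategory.Hom.hom ht
    obtain ⟨t', ht'⟩ := hs t.hom fun j hj => comp_eq_zero_of_biproductDesc_comp ht0 hj
    exact ⟨ObjectProperty.homMk t', by ext; exact ht'⟩
  refine CokernelCofork.IsColimit.ofπ _ _ (fun t ht => (key t ht).choose)
    (fun t ht => (key t ht).choose_spec) fun t ht m hm => ?_
  ext
  rw [← cancel_epi q.hom]
  exact congrArg InducedCategory.Hom.hom (hm.trans (key t ht).choose_spec.symm)

/-- Cokernel sequences are exact up to refinements. -/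
lemma exists_lift_of_isColimit {Z Y X : P.FullSubcategory} (p : Z ⟶ Y) (q : Y ⟶ X) (h : p ≫ q = 0)
    (hq : IsColimit (CokernelCofork.ofπ q h)) {A : P.FullSubcategory} (f : A ⟶ Y)
    (hf : f ≫ q = 0) :
    ∃ (A' : P.FullSubcategory) (c : A' ⟶ A) (n : A' ⟶ Z), Epi c.hom ∧ n ≫ p = c ≫ f := by
  have hex := (hP.exact_of_isColimit p q h hq).2
  have := hex.epi_kernelLift
  obtain ⟨A', c, n, hc, hn⟩ := hP.exists_lift (kernel.lift q.hom p.hom _) A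
    (kernel.lift q.hom f.hom (congrArg InducedCategory.Hom.hom hf))
  refine ⟨A', c, ObjectProperty.homMk n, hc, ?_⟩
  ext
  simpa using hn =≫ kernel.ι q.hom

end IsEmbeddingGenerator

/-! ### Sheaf and kernel conditions in terms of elements. -/

section Presheaves

variable {k : Type w} [CommRing k] {a : Type u} [Category.{v} a] [Preadditive a] [Linear k a]

lemma mem_pullback {A B : a} {f : B ⟶ A} {R : LinearSieve k A} {C : a} {g : C ⟶ B} :
    g ∈ (R.pullback f).arrows C ↔ g ≫ f ∈ R.arrows C := Iff.rfl

omit [Preadditive a] [Linear k a] in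
lemma map_comp_apply (F : aᵒᵖ ⥤ ModuleCat.{v} k) {A B D : a} (f : A ⟶ B) (g : B ⟶ D)
    (x : F.obj (op D)) : F.map (f ≫ g).op x = F.map f.op (F.map g.op x) := by
  rw [op_comp, F.map_comp]
  rfl

/-- The morphism `a(-, A) ⟶ F` given by an element of `F(A)`. -/
def IsLinearPresheaf.homOfElement {F : aᵒᵖ ⥤ ModuleCat.{v} k} (hF : IsLinearPresheaf k a F) {A : a}
    (x : F.obj (op A)) : (linearYoneda k a).obj A ⟶ F where
  app B := ModuleCat.ofHom
    { toFun f := F.map (Quiver.Hom.op (show B.unop ⟶ A from f)) x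
      map_add' f g := by
        have := hF.1
        change F.map (Quiver.Hom.op (show B.unop ⟶ A from f) + Quiver.Hom.op (show B.unop ⟶ A from g)) x = _
        rw [F.map_add]
        rfl
      map_smul' r f := by
        change F.map (r • (show B.unop ⟶ A from f)).op x = _
        rw [hF.2]
        rfl }
  naturality B B' g := by
    ext f
    change F.map (g.unop ≫ (show B.unop ⟶ A from f)).op x = F.map g (F.map _ x)
    rw [op_comp, F.map_comp]
    rfl

lemma linearYoneda_hom_app {F : aᵒᵖ ⥤ ModuleCat.{v} k} {A : a} (φ : (linearYoneda k a).obj A ⟶ F)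
    {B : a} (f : B ⟶ A) :
    φ.app (op B) f = F.map f.op (φ.app (op A) (𝟙 A)) := by
  have := congrArg (fun m => m.hom (𝟙 A)) (φ.naturality f.op)
  refine Eq.trans ?_ this
  change _ = φ.app (op B) (f ≫ 𝟙 A)
  rw [Category.comp_id]

lemma linearYoneda_hom_ext {F : aᵒᵖ ⥤ ModuleCat.{v} k} {A : a}
    {φ ψ : (linearYoneda k a).obj A ⟶ F} (h : φ.app (op A) (𝟙 A) = ψ.app (op A) (𝟙 A)) : φ = ψ := by
  ext B f
  exact (linearYoneda_hom_app φ f).trans ((congrArg _ h).trans (linearYoneda_hom_app ψ f).symm)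

lemma IsLinearPresheaf.homOfElement_id {F : aᵒᵖ ⥤ ModuleCat.{v} k} (hF : IsLinearPresheaf k a F)
    {A : a} (x : F.obj (op A)) : (hF.homOfElement x).app (op A) (𝟙 A) = x := by
  change F.map (𝟙 (op A)) x = x
  rw [F.map_id]
  rfl

lemma sieve_hom_naturality {F : aᵒᵖ ⥤ ModuleCat.{v} k} {A : a} {R : LinearSieve k A}
    (ψ : R.toFunctor ⟶ F) {B B' : a} (g : B' ⟶ B) (f : B ⟶ A) (hf : f ∈ R.arrows B) :
    ψ.app (op B') ⟨g ≫ f, R.precomp_mem g f hf⟩ = F.map g.op (ψ.app (op B) ⟨f, hf⟩) :=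
  congrArg (fun m => m.hom ⟨f, hf⟩) (ψ.naturality g.op)

/-- The sheaf condition in terms of elements. -/
lemma isSheaf_iff {T : CoveringSystem k a} {F : aᵒᵖ ⥤ ModuleCat.{v} k} :
    IsSheaf T F ↔ IsLinearPresheaf k a F ∧ ∀ (A : a) (R : LinearSieve k A), R ∈ T A →
      (∀ x : F.obj (op A), (∀ (B : a) (f : B ⟶ A), f ∈ R.arrows B → F.map f.op x = 0) → x = 0) ∧
      ∀ ψ : R.toFunctor ⟶ F, ∃ x : F.obj (op A), ∀ (B : a) (f : B ⟶ A) (hf : f ∈ R.arrows B),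
        F.map f.op x = ψ.app (op B) ⟨f, hf⟩ := by
  refine and_congr_right fun hF => forall_congr' fun A => forall₂_congr fun R _ => ?_
  have hcomp (φ : (linearYoneda k a).obj A ⟶ F) (B : a) (f : B ⟶ A) (hf : f ∈ R.arrows B) :
      (R.incl ≫ φ).app (op B) ⟨f, hf⟩ = F.map f.op (φ.app (op A) (𝟙 A)) :=
    linearYoneda_hom_app φ f
  constructor
  · rintro ⟨hi, hs⟩
    refine ⟨fun x hx => ?_, fun ψ => ?_⟩
    · have : hF.homOfElement x = hF.homOfElement 0 := by
        refine hi ?_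
        ext B ⟨f, hf⟩
        refine (hcomp _ _ f hf).trans (Eq.trans ?_ (hcomp _ _ f hf).symm)
        rw [hF.homOfElement_id, hF.homOfElement_id, hx _ f hf, map_zero]
      rw [← hF.homOfElement_id x, this, hF.homOfElement_id]
    · obtain ⟨φ, rfl⟩ := hs ψ
      exact ⟨φ.app (op A) (𝟙 A), fun B f hf => (hcomp φ B f hf).symm⟩
  · rintro ⟨hi, hs⟩
    refine ⟨fun φ φ' h => linearYoneda_hom_ext (sub_eq_zero.1 (hi _ fun B f hf => ?_)), fun ψ => ?_⟩
    · rw [map_sub, ← hcomp φ B f hf, ← hcomp φ' B f hf, sub_eq_zero]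
      exact congrArg (fun m : R.toFunctor ⟶ F => m.app (op B) ⟨f, hf⟩) h
    · obtain ⟨x, hx⟩ := hs ψ
      refine ⟨hF.homOfElement x, ?_⟩
      ext B ⟨f, hf⟩
      exact (hcomp _ _ f hf).trans (by rw [hF.homOfElement_id]; exact hx _ f hf)

/-- For every right exact sequence `Z ⟶ Y ⟶ X`, the sequence `0 ⟶ F(X) ⟶ F(Y) ⟶ F(Z)` is exact. -/
def DescendsAlongCokernels (F : aᵒᵖ ⥤ ModuleCat.{v} k) : Prop :=
  ∀ ⦃Z Y X : a⦄ (p : Z ⟶ Y) (q : Y ⟶ X) (h : p ≫ q = 0),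
    Nonempty (IsColimit (CokernelCofork.ofπ q h)) →
    (∀ x : F.obj (op X), F.map q.op x = 0 → x = 0) ∧
      ∀ y : F.obj (op Y), F.map p.op y = 0 → ∃ x : F.obj (op X), F.map q.op x = y

lemma isIso_kernelLift_iff {K M N : ModuleCat.{v} k} (α : K ⟶ M) (β : M ⟶ N) (h : α ≫ β = 0) :
    IsIso (kernel.lift β α h) ↔
      (∀ x : K, α x = 0 → x = 0) ∧ ∀ y : M, β y = 0 → ∃ x : K, α x = y := by
  have h1 : Mono (kernel.lift β α h) ↔ ∀ x : K, α x = 0 → x = 0 := by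
    rw [← injective_iff_map_eq_zero α.hom, ← ModuleCat.mono_iff_injective]
    refine ⟨fun _ => ?_, fun _ => ?_⟩
    · rw [← kernel.lift_ι β α h]
      infer_instance
    · have : Mono (kernel.lift β α h ≫ kernel.ι β) := by rwa [kernel.lift_ι]
      exact mono_of_mono _ (kernel.ι β)
  have h2 : Epi (kernel.lift β α h) ↔ ∀ y : M, β y = 0 → ∃ x : K, α x = y := by
    rw [← ShortComplex.exact_iff_epi_kernel_lift (ShortComplex.mk α β h),
      ShortComplex.moduleCat_exact_iff]
  rw [← h1, ← h2]
  exact ⟨fun _ => ⟨inferInstance, inferInstance⟩, fun ⟨_, _⟩ => isIso_of_mono_of_epi _⟩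

/-- The two conditions differ by the choice of cokernel; `F` is transported along the isomorphism
`e` with the chosen one. -/
lemma sendsCokernelsToKernels_iff {F : aᵒᵖ ⥤ ModuleCat.{v} k} :
    SendsCokernelsToKernels k a F ↔ IsLinearPresheaf k a F ∧ DescendsAlongCokernels F := by
  refine and_congr_right fun hF => ⟨fun hF' Z Y X p q h ⟨hq⟩ => ?_, fun hF' Z Y f _ => ?_⟩
  · have : HasCokernel p := ⟨⟨⟨_, hq⟩⟩⟩
    obtain ⟨h0, hiso⟩ := hF' p
    rw [isIso_kernelLift_iff] at hiso
    let e : X ≅ cokernel p := hq.coconePointUniqueUpToIso (colimit.isColimit (parallelPair p 0))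
    have he : q = cokernel.π p ≫ e.inv :=
      (hq.comp_coconePointUniqueUpToIso_inv (colimit.isColimit (parallelPair p 0))
        WalkingParallelPair.one).symm
    have hmap (x : F.obj (op X)) :
        F.map q.op x = F.map (cokernel.π p).op (F.map e.inv.op x) := by
      rw [he, op_comp, F.map_comp]
      rfl
    have hei (x : F.obj (op X)) : F.map e.hom.op (F.map e.inv.op x) = x := by
      have := congrArg (fun m => m.hom x) (F.map_comp e.inv.op e.hom.op)
      refine this.symm.trans ?_
      rw [← op_comp, e.hom_inv_id, op_id, F.map_id]
      rfl
    have hie (x : F.obj (op (cokernel p))) : F.map e.inv.op (F.map e.hom.op x) = x := by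
      have := congrArg (fun m => m.hom x) (F.map_comp e.hom.op e.inv.op)
      refine this.symm.trans ?_
      rw [← op_comp, e.inv_hom_id, op_id, F.map_id]
      rfl
    refine ⟨fun x hx => ?_, fun y hy => ?_⟩
    · rw [hmap] at hx
      rw [← hei x, hiso.1 _ hx, map_zero]
    · obtain ⟨x, rfl⟩ := hiso.2 y hy
      exact ⟨F.map e.hom.op x, by rw [hmap, hie]⟩
  · have := hF.1
    have h0 : F.map (cokernel.π f).op ≫ F.map f.op = 0 := by
      rw [← F.map_comp, ← op_comp, cokernel.condition, op_zero, F.map_zero]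
    exact ⟨h0, (isIso_kernelLift_iff _ _ h0).2
      (hF' f (cokernel.π f) (cokernel.condition f) ⟨cokernelIsCokernel f⟩)⟩

end Presheaves

/-- The formal morphism with a single component. -/
def FormalCover.single {a : Type u} [Category.{v} a] {Y X : a} (q : Y ⟶ X) : FormalCover X :=
  ⟨⟨PUnit, fun _ => Y⟩, fun _ => q⟩

section Generate

variable {k : Type w} [CommRing k] {a : Type u} [Category.{v} a] [Preadditive a] [Linear k a]

variable (k) in
/-- The sieve of multiples of a morphism. -/
def LinearSieve.generate {Y X : a} (q : Y ⟶ X) : LinearSieve k X where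
  arrows B := LinearMap.range (Linear.rightComp k B q)
  precomp_mem B C g f := by
    rintro ⟨h, rfl⟩
    exact ⟨g ≫ h, by simp⟩

lemma LinearSieve.mem_generate {Y X B : a} {q : Y ⟶ X} {f : B ⟶ X} :
    f ∈ (LinearSieve.generate k q).arrows B ↔ ∃ g : B ⟶ Y, g ≫ q = f := Iff.rfl

end Generate

/-! ### The topology generated by right exact sequences, and its sheaves. -/

namespace IsEmbeddingGenerator

variable {C : Type u} [Category.{v} C] [Abelian C] [IsGrothendieckAbelian.{v} C]
  {P : ObjectProperty C} (hP : IsEmbeddingGenerator P)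
  [EssentiallySmall.{v} P.FullSubcategory] [HasFiniteBiproducts P.FullSubcategory]
  {k : Type w} [CommRing k] [Linear k C]
include hP

omit [EssentiallySmall.{v} P.FullSubcategory] [HasFiniteBiproducts P.FullSubcategory] in
lemma exists_epi_of_mem_CoIter (n : ℕ) : ∀ {X : P.FullSubcategory} {r : FormalCover X},
    r ∈ CoIter (rightExactSeqs P.FullSubcategory) n X → ∃ i, Epi (r.hom i).hom := by
  have h1 : ∀ {X : P.FullSubcategory} {r : FormalCover X},
      r ∈ Co (rightExactSeqs P.FullSubcategory) X → ∃ i, Epi (r.hom i).hom := by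
    rintro X r ⟨s, ⟨Z, Y, p, q, h, ⟨hq⟩, rfl⟩, rfl⟩
    exact ⟨PUnit.unit, (hP.exact_of_isColimit p q h hq).1⟩
  induction n using Nat.strong_induction_on with
  | _ n ih =>
    match n, ih with
    | 0, _ =>
      rintro X r rfl
      exact ⟨PUnit.unit, inferInstanceAs (Epi (𝟙 X.obj))⟩
    | 1, _ =>
      intro X r hr
      exact h1 hr
    | n + 2, ih =>
      rintro X r ⟨v, hv, w, hw, rfl⟩
      obtain ⟨i, _⟩ := ih (n + 1) (by omega) hv
      obtain ⟨j, _⟩ := h1 (hw i)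
      exact ⟨⟨i, j⟩, epi_comp ((w i).hom j).hom (v.hom i).hom⟩

lemma single_mem_CoTilde {Y X : P.FullSubcategory} (q : Y ⟶ X) [Epi q.hom] :
    FormalCover.single q ∈ CoTilde (rightExactSeqs P.FullSubcategory) X := by
  obtain ⟨Z, p, h, hq⟩ := hP.exists_isColimit_of_epi q
  exact ⟨1, FormalSeq.ofPair p q h, ⟨Z, Y, p, q, h, hq, rfl⟩, rfl⟩

/-- A sieve is covering if and only if it contains an epimorphism of the ambient category. -/
lemma mem_top_iff {X : P.FullSubcategory} {R : LinearSieve k X} :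
    R ∈ top k (rightExactSeqs P.FullSubcategory) X ↔
      ∃ (Y : P.FullSubcategory) (q : Y ⟶ X), Epi q.hom ∧ q ∈ R.arrows Y := by
  constructor
  · rintro ⟨r, ⟨n, hr⟩, hR⟩
    obtain ⟨i, hi⟩ := hP.exists_epi_of_mem_CoIter n hr
    exact ⟨_, r.hom i, hi, hR _ (Submodule.mem_iSup_of_mem i ⟨𝟙 _, by simp⟩)⟩
  · rintro ⟨Y, q, _, hR⟩
    refine ⟨_, hP.single_mem_CoTilde q, fun B => iSup_le fun _ => ?_⟩
    rintro _ ⟨g, rfl⟩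
    exact R.precomp_mem g q hR

/-- (PTa) is lifting along an epimorphism up to refinement and (PTb) is exactness up to refinement;
what remains are sums over a one-point index. -/
theorem isPretopology : IsPretopology (rightExactSeqs P.FullSubcategory) where
  pta := by
    rintro X A _ ⟨s, ⟨Z, Y, p, q, h, ⟨hq⟩, rfl⟩, rfl⟩ f
    have := (hP.exact_of_isColimit p q h hq).1
    obtain ⟨A', c, n, _, hn⟩ := hP.exists_lift q.hom A f.hom
    refine ⟨_, hP.single_mem_CoTilde c,
      fun _ => DirectSum.of (fun _ : PUnit.{v + 1} => (A' ⟶ Y)) PUnit.unit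
        (ObjectProperty.homMk n), fun δ => ?_⟩
    have e : (DirectSum.of (fun _ : PUnit.{v + 1} => (A' ⟶ Y)) PUnit.unit
      (ObjectProperty.homMk n)) PUnit.unit = ObjectProperty.homMk n := DirectSum.of_eq_same _ _
    have hn' : ObjectProperty.homMk n ≫ q = c ≫ f := by ext; exact hn
    refine (finsum_unique (α := PUnit.{v + 1}) _).trans ?_
    exact (congrArg (· ≫ q) e).trans hn'
  ptb := by
    rintro X A _ ⟨Z, Y, p, q, h, ⟨hq⟩, rfl⟩ f hf
    have hf' : (show A ⟶ Y from f PUnit.unit) ≫ q = 0 :=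
      (finsum_unique (α := PUnit.{v + 1}) _).symm.trans hf
    obtain ⟨A', c, n, _, hn⟩ := hP.exists_lift_of_isColimit p q h hq _ hf'
    refine ⟨_, hP.single_mem_CoTilde c,
      fun _ => DirectSum.of (fun _ : PUnit.{v + 1} => (A' ⟶ Z)) PUnit.unit n, fun _ _ => ?_⟩
    have e : (DirectSum.of (fun _ : PUnit.{v + 1} => (A' ⟶ Z)) PUnit.unit n) PUnit.unit = n :=
      DirectSum.of_eq_same _ _
    have e' : (DirectSum.of (fun _ : PUnit.{v + 1} => (Z ⟶ Y)) PUnit.unit p) PUnit.unit = p :=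
      DirectSum.of_eq_same _ _
    refine (finsum_unique (α := PUnit.{v + 1}) _).trans ?_
    exact (congrArg₂ (· ≫ ·) e e').trans hn

theorem isTopology_top :
    IsTopology (k := k) (top k (rightExactSeqs P.FullSubcategory)) where
  maximal_mem A := hP.mem_top_iff.2 ⟨A, 𝟙 A, inferInstanceAs (Epi (𝟙 A.obj)), Submodule.mem_top⟩
  pullback_mem A B f R hR := by
    obtain ⟨Y, q, _, hq⟩ := hP.mem_top_iff.1 hR
    obtain ⟨B', c, n, hc, hn⟩ := hP.exists_lift q.hom B f.hom
    refine hP.mem_top_iff.2 ⟨B', c, hc, ?_⟩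
    have : c ≫ f = ObjectProperty.homMk n ≫ q := by ext; exact hn.symm
    rw [mem_pullback, this]
    exact R.precomp_mem _ q hq
  local_mem A S R hR h := by
    obtain ⟨Y, q, _, hq⟩ := hP.mem_top_iff.1 hR
    obtain ⟨Y', q', _, hq'⟩ := hP.mem_top_iff.1 (h Y q hq)
    exact hP.mem_top_iff.2 ⟨Y', q' ≫ q, epi_comp q'.hom q.hom, hq'⟩

omit [Linear k C] in
lemma eq_zero_of_map_epi {F : P.FullSubcategoryᵒᵖ ⥤ ModuleCat.{v} k}
    (hF : DescendsAlongCokernels F) {Y X : P.FullSubcategory} (q : Y ⟶ X) [Epi q.hom]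
    {x : F.obj (op X)} (hx : F.map q.op x = 0) : x = 0 := by
  obtain ⟨Z, p, h, hq⟩ := hP.exists_isColimit_of_epi q
  exact (hF p q h hq).1 x hx

/-- A sheaf is separated along epimorphisms, and an element of `F(Y)` killed by `p` amounts to a
morphism to `F` from the sieve generated by `q`. Conversely, a morphism from a covering sieve is
determined by its value on one epimorphism in the sieve. -/
lemma isSheaf_top_iff {F : P.FullSubcategoryᵒᵖ ⥤ ModuleCat.{v} k} :
    IsSheaf (top k (rightExactSeqs P.FullSubcategory)) F ↔
      IsLinearPresheaf k P.FullSubcategory F ∧ DescendsAlongCokernels F := by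
  rw [isSheaf_iff]
  refine and_congr_right fun hF => ⟨fun hF' => ?_, fun hF' A R hR => ⟨fun x hx => ?_, fun ψ => ?_⟩⟩
  · have := hF.1
    have hinj {Y X : P.FullSubcategory} (q : Y ⟶ X) [Epi q.hom] (x : F.obj (op X))
        (hx : F.map q.op x = 0) : x = 0 := by
      refine (hF' X (LinearSieve.generate k q) (hP.mem_top_iff.2 ⟨Y, q, inferInstance,
        LinearSieve.mem_generate.2 ⟨𝟙 Y, Category.id_comp q⟩⟩)).1 x fun B f hf => ?_
      obtain ⟨g, rfl⟩ := LinearSieve.mem_generate.1 hf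
      rw [map_comp_apply, hx, map_zero]
    intro Z Y X p q h ⟨hq⟩
    have hepi := (hP.exact_of_isColimit p q h hq).1
    refine ⟨hinj q, fun y hy => ?_⟩
    -- Locally `g` factors through `p`, which kills `y`; separatedness removes the refinement.
    have hzero {B : P.FullSubcategory} (g : B ⟶ Y) (hg : g ≫ q = 0) : F.map g.op y = 0 := by
      obtain ⟨B', c, n, _, hn⟩ := hP.exists_lift_of_isColimit p q h hq g hg
      refine hinj c _ ?_
      rw [← map_comp_apply, ← hn, map_comp_apply, hy, map_zero]
    have hwd {B : P.FullSubcategory} (g g' : B ⟶ Y) (hg : g ≫ q = g' ≫ q) :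
        F.map g.op y = F.map g'.op y := by
      have h0 := hzero (g - g') (by rw [Preadditive.sub_comp, hg, sub_self])
      have h1 : F.map (g - g').op y = F.map g.op y - F.map g'.op y := by
        rw [op_sub, F.map_sub]
        rfl
      rwa [h1, sub_eq_zero] at h0
    -- `ψ` sends `g ≫ q` to the restriction of `y` along `g`; by `hwd` the choice of `g` is
    -- immaterial.
    let ψ : (LinearSieve.generate k q).toFunctor ⟶ F :=
      { app B := ModuleCat.ofHom
          { toFun f := F.map f.2.choose.op y
            map_add' f g := by
              refine (hwd _ (f.2.choose + g.2.choose) ?_).trans ?_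
              · rw [Preadditive.add_comp]
                exact (f + g).2.choose_spec.trans
                  (congrArg₂ (· + ·) f.2.choose_spec g.2.choose_spec).symm
              · rw [op_add, F.map_add]
                rfl
            map_smul' r f := by
              refine (hwd _ (r • f.2.choose) ?_).trans ?_
              · rw [Linear.smul_comp]
                exact (r • f).2.choose_spec.trans (congrArg (r • ·) f.2.choose_spec).symm
              · rw [hF.2]
                rfl }
        naturality B B' g := by
          ext f
          refine Eq.trans (hwd _ (g.unop ≫ f.2.choose) ?_) (map_comp_apply F _ _ _)
          rw [Category.assoc]
          exact ((LinearSieve.generate k q).toFunctor.map g f).2.choose_spec.trans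
            (congrArg (g.unop ≫ ·) f.2.choose_spec.symm) }
    have hqm : q ∈ (LinearSieve.generate k q).arrows Y :=
      LinearSieve.mem_generate.2 ⟨𝟙 Y, Category.id_comp q⟩
    obtain ⟨x, hx⟩ := (hF' X (LinearSieve.generate k q)
      (hP.mem_top_iff.2 ⟨Y, q, inferInstance, hqm⟩)).2 ψ
    refine ⟨x, (hx Y q hqm).trans ?_⟩
    refine (hwd hqm.choose (𝟙 Y) (hqm.choose_spec.trans (Category.id_comp q).symm)).trans ?_
    rw [op_id, F.map_id]
    rfl
  · obtain ⟨Y, q, _, hq⟩ := hP.mem_top_iff.1 hR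
    exact hP.eq_zero_of_map_epi hF' q (hx Y q hq)
  · obtain ⟨Y, q, _, hq⟩ := hP.mem_top_iff.1 hR
    obtain ⟨Z, p, h, hqc⟩ := hP.exists_isColimit_of_epi q
    obtain ⟨x, hx⟩ := (hF' p q h hqc).2 (ψ.app (op Y) ⟨q, hq⟩) (by
      rw [← sieve_hom_naturality]
      have : (⟨p ≫ q, R.precomp_mem p q hq⟩ : R.arrows Z) = 0 := Subtype.ext h
      exact (congrArg (ψ.app (op Z)) this).trans (map_zero _))
    refine ⟨x, fun B f hf => ?_⟩
    -- After refinement by `c`, an arbitrary `f` in `R` factors through `q`, where `x` was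
    -- constructed.
    obtain ⟨B', c, n, _, hn⟩ := hP.exists_lift q.hom B f.hom
    have hn' : c ≫ f = ObjectProperty.homMk n ≫ q := by ext; exact hn.symm
    refine sub_eq_zero.1 (hP.eq_zero_of_map_epi hF' c ?_)
    rw [map_sub, sub_eq_zero, ← map_comp_apply, hn', map_comp_apply, hx, ← sieve_hom_naturality,
      ← sieve_hom_naturality]
    exact congrArg (ψ.app (op B')) (Subtype.ext hn'.symm)

lemma isSheaf_top_eq : IsSheaf (top k (rightExactSeqs P.FullSubcategory)) =
    SendsCokernelsToKernels k P.FullSubcategory := by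
  ext F
  rw [hP.isSheaf_top_iff, sendsCokernelsToKernels_iff]

end IsEmbeddingGenerator

/-! ### The restricted Yoneda functor: full faithfulness and essential image. -/

section RestrictedYoneda

variable {C : Type u} [Category.{v} C] [Preadditive C] {P : ObjectProperty C}
  {k : Type w} [CommRing k] [Linear k C]

/-- The value of a morphism of presheaves `C(-, N) ⟶ F` on an element. -/
def evalHom {N : C} {F : P.FullSubcategoryᵒᵖ ⥤ ModuleCat.{v} k}
    (θ : (restrictedYoneda k P).obj N ⟶ F) {B : P.FullSubcategory} :
    (B.obj ⟶ N) →ₗ[k] F.obj (op B) :=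
  (θ.app (op B)).hom

lemma evalHom_comp {N : C} {F : P.FullSubcategoryᵒᵖ ⥤ ModuleCat.{v} k}
    (θ : (restrictedYoneda k P).obj N ⟶ F) {B B' : P.FullSubcategory} (c : B' ⟶ B)
    (n : B.obj ⟶ N) : evalHom θ (c.hom ≫ n) = F.map c.op (evalHom θ n) :=
  congrArg (fun m => m.hom n) (θ.naturality c.op)

/-- A morphism of presheaves `C(-, N) ⟶ F` given by a natural family of linear maps. -/
def homOfEval {N : C} {F : P.FullSubcategoryᵒᵖ ⥤ ModuleCat.{v} k}
    (θ : ∀ B : P.FullSubcategory, (B.obj ⟶ N) →ₗ[k] F.obj (op B))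
    (h : ∀ ⦃B B' : P.FullSubcategory⦄ (c : B' ⟶ B) (n : B.obj ⟶ N),
      θ B' (c.hom ≫ n) = F.map c.op (θ B n)) : (restrictedYoneda k P).obj N ⟶ F where
  app B := ModuleCat.ofHom (θ B.unop)
  naturality B B' c := by
    ext n
    exact h c.unop n

lemma isLinearPresheaf_restrictedYoneda (M : C) :
    IsLinearPresheaf k P.FullSubcategory ((restrictedYoneda k P).obj M) := by
  refine ⟨⟨fun {X Y f g} => ?_⟩, fun X Y r f => ?_⟩
  · ext n
    exact Preadditive.add_comp _ _ _ f.unop.hom g.unop.hom n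
  · ext n
    exact Linear.smul_comp _ _ _ r f.hom n

instance : (restrictedYoneda k P).Additive where
  map_add {M N f g} := by
    ext B n
    exact Preadditive.comp_add _ _ _ n f g

instance : (restrictedYoneda k P).Linear k where
  map_smul {M N} f r := by
    ext B n
    exact Linear.comp_smul _ _ _ n r f

end RestrictedYoneda

namespace IsEmbeddingGenerator

variable {C : Type u} [Category.{v} C] [Abelian C] [IsGrothendieckAbelian.{v} C]
  {P : ObjectProperty C} (hP : IsEmbeddingGenerator P) {k : Type w} [CommRing k] [Linear k C]
include hP

lemma descendsAlongCokernels_restrictedYoneda (M : C) :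
    DescendsAlongCokernels ((restrictedYoneda k P).obj M) := by
  rintro Z Y X p q h ⟨hq⟩
  obtain ⟨hepi, hex⟩ := hP.exact_of_isColimit p q h hq
  refine ⟨fun x hx => zero_of_epi_comp q.hom hx, fun y hy => ?_⟩
  exact ⟨hex.desc (show Y.obj ⟶ M from y) hy, hex.g_desc _ _⟩

omit [IsGrothendieckAbelian.{v} C] in
lemma faithful_restrictedYoneda : (restrictedYoneda k P).Faithful where
  map_injective {_ _ f g} h := hP.generator f g fun G hG n =>
    congrArg (fun φ => evalHom φ (B := ⟨G, hG⟩) n) h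

variable [EssentiallySmall.{v} P.FullSubcategory]

/-- `M` is a quotient of the coproduct of all morphisms to it from representatives. The values of
`φ` define a map `ψ` on this coproduct, which must be shown to descend to `M`. -/
lemma full_restrictedYoneda : (restrictedYoneda k P).Full where
  map_surjective {M N} φ := by
    let φ' {B : P.FullSubcategory} : (B.obj ⟶ M) →ₗ[k] (B.obj ⟶ N) := evalHom φ
    have hφ' {B B' : P.FullSubcategory} (c : B' ⟶ B) (n : B.obj ⟶ M) :
        φ' (c.hom ≫ n) = c.hom ≫ φ' n := evalHom_comp φ c n
    let A (j : MapsTo P M) : C := (representative j.1).obj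
    let π : ∐ A ⟶ M := Sigma.desc fun j => j.2
    let ψ : ∐ A ⟶ N := Sigma.desc fun j => φ' j.2
    have hιπ (j : MapsTo P M) : Sigma.ι A j ≫ π = j.2 := Sigma.ι_desc _ _
    have hιψ (j : MapsTo P M) : Sigma.ι A j ≫ ψ = φ' j.2 := Sigma.ι_desc _ _
    have hπ : Epi π := Preadditive.epi_of_cancel_zero _ fun t ht => hP.eq_zero t fun j => by
      rw [← hιπ, Category.assoc, ht, comp_zero]
    -- A morphism from a compact object meets only finitely many summands, so naturality and
    -- additivity of `φ` compute its composite with `ψ`.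
    have hker : kernel.ι π ≫ ψ = 0 := hP.eq_zero _ fun b => by
      have := hP.compact _ (representative b.1).property
      obtain ⟨s, hs⟩ := exists_finset_eq_sum (b.2 ≫ kernel.ι π)
      have h1 : ∑ j ∈ s, ((b.2 ≫ kernel.ι π) ≫ sigmaProj A j) ≫ j.2 = 0 := by
        have := hs =≫ π
        rw [Category.assoc, kernel.condition, comp_zero, Preadditive.sum_comp] at this
        simpa [hιπ] using this.symm
      rw [← Category.assoc, hs, Preadditive.sum_comp, ← map_zero φ', ← h1, map_sum]
      refine Finset.sum_congr rfl fun j _ => ?_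
      have := hφ' (ObjectProperty.homMk ((b.2 ≫ kernel.ι π) ≫ sigmaProj A j)) j.2
      refine Eq.trans ?_ this.symm
      simp [hιψ]
    obtain ⟨g, hg⟩ := CokernelCofork.IsColimit.desc'
      (Abelian.epiIsCokernelOfKernel _ (kernelIsKernel π)) ψ hker
    change π ≫ g = ψ at hg
    have hg' {B : P.FullSubcategory} (f : B.obj ⟶ M) : f ≫ g = φ' f := by
      obtain ⟨B', ⟨e⟩⟩ := exists_iso_representative B
      have hj (j : MapsTo P M) : j.2 ≫ g = φ' j.2 := by
        rw [← hιψ, ← hg, ← Category.assoc, hιπ]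
      have hj : (e.inv.hom ≫ f) ≫ g = φ' (e.inv.hom ≫ f) := hj ⟨B', e.inv.hom ≫ f⟩
      rwa [hφ', Category.assoc, cancel_epi] at hj
    refine ⟨g, ?_⟩
    ext A f
    exact hg' f

variable [HasFiniteBiproducts P.FullSubcategory]

/-- A presheaf which descends along cokernels is isomorphic to `C(-, M)` if it is a quotient of
`C(-, N)` with the same kernel as `C(-, N) ⟶ C(-, M)`, for an epimorphism `N ⟶ M`. -/
lemma nonempty_iso_of_surjective {F : P.FullSubcategoryᵒᵖ ⥤ ModuleCat.{v} k}
    (hF : DescendsAlongCokernels F) {N M : C} (θ : (restrictedYoneda k P).obj N ⟶ F)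
    (hθ : ∀ {B : P.FullSubcategory} (x : F.obj (op B)), ∃ n : B.obj ⟶ N, evalHom θ n = x)
    (π : N ⟶ M) [Epi π]
    (h : ∀ {B : P.FullSubcategory} (n : B.obj ⟶ N), evalHom θ n = 0 ↔ n ≫ π = 0) :
    Nonempty ((restrictedYoneda k P).obj M ≅ F) := by
  have hwd {B : P.FullSubcategory} (n n' : B.obj ⟶ N) :
      evalHom θ n = evalHom θ n' ↔ n ≫ π = n' ≫ π := by
    rw [← sub_eq_zero, ← map_sub, h, Preadditive.sub_comp, sub_eq_zero]
  choose σ hσ using @hθ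
  let ψ : F ⟶ (restrictedYoneda k P).obj M :=
    { app B := ModuleCat.ofHom
        { toFun x := (σ x ≫ π : B.unop.obj ⟶ M)
          map_add' x y := by
            refine Eq.trans ?_ (Preadditive.add_comp _ _ _ (σ x) (σ y) π)
            rw [← hwd, map_add, hσ, hσ, hσ]
          map_smul' r x := by
            refine Eq.trans ?_ (Linear.smul_comp _ _ _ r (σ x) π)
            rw [← hwd, map_smul, hσ, hσ] }
      naturality B B' c := by
        ext x
        change σ (F.map c x) ≫ π = c.unop.hom ≫ σ x ≫ π
        rw [← Category.assoc, ← hwd, evalHom_comp, hσ, hσ]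
        rfl }
  have hψ (B : P.FullSubcategoryᵒᵖ) : IsIso (ψ.app B) := by
    rw [ConcreteCategory.isIso_iff_bijective]
    constructor
    · intro x y hxy
      have : σ x ≫ π = σ y ≫ π := hxy
      rwa [← hwd, hσ, hσ] at this
    · rintro (m : B.unop.obj ⟶ M)
      -- `m` lifts to `N` only after an epimorphism `c`; the image of the lift in `F` then descends
      -- along `c`.
      obtain ⟨A, c, n, _, hn⟩ := hP.exists_lift π B.unop m
      obtain ⟨Z, z, hz, hc⟩ := hP.exists_isColimit_of_epi c
      have hz' : z.hom ≫ c.hom = 0 := congrArg InducedCategory.Hom.hom hz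
      obtain ⟨x, hx⟩ := (hF z c hz hc).2 (evalHom θ n) (by
        rw [← evalHom_comp, h, Category.assoc, hn, ← Category.assoc, hz', zero_comp])
      refine ⟨x, ?_⟩
      change σ x ≫ π = m
      rw [← cancel_epi c.hom, ← hn, ← Category.assoc, ← hwd, evalHom_comp, hσ, hx]
  have : IsIso ψ := NatIso.isIso_of_isIso_app ψ
  exact ⟨(asIso ψ).symm⟩

/-- A presentation of `F`: generators are all its elements over representatives (`I`), relations all
morphisms to `∐ A` whose value in `F` is zero (`J`). The cokernel of `∐ D ⟶ ∐ A` represents `F`. -/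
lemma mem_essImage_restrictedYoneda {F : P.FullSubcategoryᵒᵖ ⥤ ModuleCat.{v} k}
    (hlin : IsLinearPresheaf k P.FullSubcategory F) (hF : DescendsAlongCokernels F) :
    ∃ M : C, Nonempty ((restrictedYoneda k P).obj M ≅ F) := by
  have := hlin.1
  let I : Type v := Σ B : SmallModel.{v} P.FullSubcategory, F.obj (op (representative B))
  let A (i : I) : C := (representative i.1).obj
  let term {B : P.FullSubcategory} (i : I) : (B.obj ⟶ ∐ A) →ₗ[k] F.obj (op B) :=
    { toFun b := F.map (ObjectProperty.homMk (b ≫ sigmaProj A i) : B ⟶ representative i.1).op i.2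
      map_add' b b' := by
        rw [Preadditive.add_comp]
        exact congrArg (fun m => m.hom i.2) (F.map_add (f := Quiver.Hom.op (ObjectProperty.homMk
          (b ≫ sigmaProj A i) : B ⟶ representative i.1)) (g := Quiver.Hom.op
            (ObjectProperty.homMk (b' ≫ sigmaProj A i) : B ⟶ representative i.1)))
      map_smul' r b := by
        rw [Linear.smul_comp]
        exact congrArg (fun m => m.hom i.2)
          (hlin.2 r (ObjectProperty.homMk (b ≫ sigmaProj A i) : B ⟶ representative i.1)) }
  have hterm {B : P.FullSubcategory} (i : I) (b : B.obj ⟶ ∐ A) (hb : b ≫ sigmaProj A i = 0) :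
      term i b = 0 := by
    change F.map (ObjectProperty.homMk (b ≫ sigmaProj A i) : B ⟶ representative i.1).op i.2 = 0
    rw [hb]
    exact congrArg (fun m => m.hom i.2) (F.map_zero (op (representative i.1)) (op B))
  have hfin {B : P.FullSubcategory} (b : B.obj ⟶ ∐ A) :
      (Function.support fun i => term i b).Finite := by
    have := hP.compact _ B.property
    exact (finite_comp_sigmaProj_ne_zero b).subset fun i hi hi' => hi (hterm i b hi')
  -- The sum over components is finite by compactness, so `finsum` takes no default value here.
  let θ : (restrictedYoneda k P).obj (∐ A) ⟶ F := homOfEval (fun B =>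
    { toFun b := ∑ᶠ i, term i b
      map_add' b b' := by
        simp_rw [map_add]
        exact finsum_add_distrib (hfin b) (hfin b')
      map_smul' r b := by
        simp_rw [map_smul]
        exact (smul_finsum' r (hfin b)).symm }) fun B B' c n => by
      refine (finsum_congr fun i => ?_).trans
        (AddMonoidHom.map_finsum (F.map c.op).hom.toAddMonoidHom (hfin n)).symm
      refine Eq.trans ?_ (map_comp_apply F c
        (ObjectProperty.homMk (n ≫ sigmaProj A i) : B ⟶ representative i.1) i.2)
      change F.map (ObjectProperty.homMk ((c.hom ≫ n) ≫ sigmaProj A i) : B' ⟶ _).op i.2 = _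
      rw [Category.assoc]
      rfl
  have hθι (i : I) : evalHom θ (B := representative i.1) (Sigma.ι A i) = i.2 := by
    refine (finsum_eq_single _ i fun j hj => hterm j _ (ι_sigmaProj_of_ne A hj.symm)).trans ?_
    change F.map (ObjectProperty.homMk (Sigma.ι A i ≫ sigmaProj A i) :
      representative i.1 ⟶ representative i.1).op i.2 = _
    rw [ι_sigmaProj_self]
    exact congrArg (fun m => m.hom i.2) (F.map_id (op (representative i.1)))
  let J : Type v := {j : MapsTo P (∐ A) // evalHom θ j.2 = 0}
  let D (j : J) : C := (representative j.1.1).obj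
  let κ : ∐ D ⟶ ∐ A := Sigma.desc fun j => j.1.2
  have hικ (j : J) : Sigma.ι D j ≫ κ = j.1.2 := Sigma.ι_desc _ _
  refine ⟨cokernel κ, hP.nonempty_iso_of_surjective hF θ (fun {B} x => ?_) (cokernel.π κ)
    fun {B} n => ⟨fun hn => ?_, fun hn => ?_⟩⟩
  · obtain ⟨B', ⟨e⟩⟩ := exists_iso_representative B
    refine ⟨e.hom.hom ≫ Sigma.ι A ⟨B', F.map e.inv.op x⟩, ?_⟩
    refine (evalHom_comp θ e.hom _).trans ((congrArg _ (hθι ⟨B', F.map e.inv.op x⟩)).trans ?_)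
    rw [← map_comp_apply, e.hom_inv_id]
    exact congrArg (fun m => m.hom x) (F.map_id (op B))
  · obtain ⟨B', ⟨e⟩⟩ := exists_iso_representative B
    let j : J := ⟨⟨B', e.inv.hom ≫ n⟩, by
      change evalHom θ (e.inv.hom ≫ n) = 0
      rw [evalHom_comp θ e.inv, hn, map_zero]⟩
    have hj : Sigma.ι D j ≫ κ = e.inv.hom ≫ n := hικ j
    rw [← cancel_epi e.inv.hom, comp_zero, ← Category.assoc, ← hj, Category.assoc,
      cokernel.condition, comp_zero]
  -- A morphism killed by the projection lifts locally to `∐ D`, hence is locally a finite sum of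
  -- multiples of relations; `F` is separated along the refinement.
  · have hex : (ShortComplex.mk κ (cokernel.π κ) (cokernel.condition κ)).Exact :=
      ShortComplex.exact_of_g_is_cokernel _ (cokernelIsCokernel κ)
    have := hex.epi_kernelLift
    obtain ⟨B', c, m, _, hm⟩ := hP.exists_lift (kernel.lift (cokernel.π κ) κ _) B
      (kernel.lift (cokernel.π κ) n hn)
    have hm' : m ≫ κ = c.hom ≫ n := by simpa using hm =≫ kernel.ι (cokernel.π κ)
    refine hP.eq_zero_of_map_epi hF c ?_
    rw [← evalHom_comp, ← hm']
    have := hP.compact _ B'.property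
    obtain ⟨s, hs⟩ := exists_finset_eq_sum m
    rw [hs, Preadditive.sum_comp, map_sum]
    refine Finset.sum_eq_zero fun j _ => ?_
    have hj : (m ≫ sigmaProj D j ≫ Sigma.ι D j) ≫ κ = (m ≫ sigmaProj D j) ≫ j.1.2 := by
      simp [hικ]
    rw [hj]
    refine (evalHom_comp θ (ObjectProperty.homMk (m ≫ sigmaProj D j)) j.1.2).trans ?_
    rw [j.2, map_zero]

end IsEmbeddingGenerator

/-! ### Covering sieves of subcanonical noetherian topologies. -/

section Topologies

variable {k : Type w} [CommRing k] {a : Type u} [Category.{v} a] [Preadditive a] [Linear k a]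

lemma isLinearPresheaf_linearYoneda (X : a) :
    IsLinearPresheaf k a ((linearYoneda k a).obj X) := by
  refine ⟨⟨fun {Y Z f g} => ?_⟩, fun Y Z r f => ?_⟩
  · ext n
    exact Preadditive.add_comp _ _ _ f.unop g.unop n
  · ext n
    exact Linear.smul_comp _ _ _ r f n

lemma descendsAlongCokernels_linearYoneda (X : a) :
    DescendsAlongCokernels ((linearYoneda k a).obj X) := by
  rintro Z Y W p q h ⟨hq⟩
  refine ⟨fun (x : W ⟶ X) hx => Cofork.IsColimit.hom_ext hq (Eq.trans hx comp_zero.symm),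
    fun y hy => ?_⟩
  obtain ⟨x, hx⟩ := CokernelCofork.IsColimit.desc' hq (show Y ⟶ X from y) hy
  exact ⟨x, hx⟩

namespace IsTopology

variable {T : CoveringSystem k a} (hT : IsTopology T)
include hT

lemma upward {A : a} {R S : LinearSieve k A} (hR : R ∈ T A) (h : R ≤ S) : S ∈ T A := by
  refine hT.local_mem S R hR fun _ f hf => ?_
  have : S.pullback f = LinearSieve.maximal _ := by
    ext D g
    exact iff_of_true (S.precomp_mem g f (h _ hf)) Submodule.mem_top
  rw [this]
  exact hT.maximal_mem _

lemma mem_of_forall_mem {A : a} {R R' S : LinearSieve k A} (hR : R ∈ T A) (hR' : R' ∈ T A)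
    (h : ∀ (B : a) (f : B ⟶ A), f ∈ R.arrows B → f ∈ R'.arrows B → f ∈ S.arrows B) : S ∈ T A :=
  hT.local_mem S R hR fun _ f hf => hT.upward (hT.pullback_mem f R' hR') fun D g hg =>
    h D (g ≫ f) (R.precomp_mem g f hf) hg

end IsTopology

variable [EssentiallySmall.{v} a]

/-- The morphisms from an object to representatives. -/
abbrev MapsFrom (X : a) : Type v := Σ A : SmallModel.{v} a, X ⟶ representative A

variable {X : a} (U : Set (MapsFrom X))

/-- The sieve of those `f` for which `f ≫ y` is a multiple of the family of all members of `U`. -/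
def multipleSieve {B : a} (y : ∀ m : U, B ⟶ representative m.1.1) : LinearSieve k B where
  arrows D :=
    { carrier := {f | ∃ h : D ⟶ X, ∀ m : U, f ≫ y m = h ≫ m.1.2}
      add_mem' := by
        rintro f f' ⟨h, hh⟩ ⟨h', hh'⟩
        exact ⟨h + h', fun m => by rw [Preadditive.add_comp, hh, hh', Preadditive.add_comp]⟩
      zero_mem' := ⟨0, fun m => by rw [zero_comp, zero_comp]⟩
      smul_mem' := by
        rintro r f ⟨h, hh⟩
        exact ⟨r • h, fun m => by rw [Linear.smul_comp, hh, Linear.smul_comp]⟩ }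
  precomp_mem D D' g f := by
    rintro ⟨h, hh⟩
    exact ⟨g ≫ h, fun m => by rw [Category.assoc, hh, Category.assoc]⟩

section

variable {T : CoveringSystem k a} (hT : IsTopology T)

/-- The families of morphisms which are locally multiples of the family of all members of `U`. -/
def locallyMultiples (B : a) : Submodule k (∀ m : U, B ⟶ representative m.1.1) where
  carrier := {y | multipleSieve U y ∈ T B}
  add_mem' := by
    intro y y' hy hy'
    refine hT.mem_of_forall_mem hy hy' ?_
    rintro D f ⟨h, hh⟩ ⟨h', hh'⟩
    exact ⟨h + h', fun m => by
      rw [Pi.add_apply, Preadditive.comp_add, hh, hh', Preadditive.add_comp]⟩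
  zero_mem' := hT.upward (hT.maximal_mem B) fun D f _ => ⟨0, fun m => by simp⟩
  smul_mem' := by
    intro r y hy
    refine hT.upward hy ?_
    rintro D f ⟨h, hh⟩
    exact ⟨r • h, fun m => by rw [Pi.smul_apply, Linear.comp_smul, hh, Linear.smul_comp]⟩

/-- Precomposition of families. -/
def precompFamily {B D : a} (c : D ⟶ B) :
    (∀ m : U, B ⟶ representative m.1.1) →ₗ[k] (∀ m : U, D ⟶ representative m.1.1) :=
  LinearMap.pi fun m => Linear.leftComp k _ c ∘ₗ LinearMap.proj m

lemma precompFamily_mem {B D : a} (c : D ⟶ B) {y : ∀ m : U, B ⟶ representative m.1.1}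
    (hy : y ∈ locallyMultiples U hT B) :
    precompFamily (k := k) U c y ∈ locallyMultiples U hT D := by
  refine hT.upward (hT.pullback_mem c _ hy) ?_
  rintro D f ⟨h, hh⟩
  exact ⟨h, fun m => by rw [← hh]; exact (Category.assoc _ _ _).symm⟩

/-- The presheaf of families which are locally multiples of the family of all members of `U`. -/
def multiplesPresheaf : aᵒᵖ ⥤ ModuleCat.{v} k where
  obj B := ModuleCat.of k (locallyMultiples U hT B.unop)
  map c := ModuleCat.ofHom
    ((precompFamily U c.unop).restrict fun _ => precompFamily_mem U hT c.unop)
  map_id _ := by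
    ext y m
    exact Category.id_comp (y.1 m)
  map_comp c d := by
    ext y m
    exact Category.assoc d.unop c.unop (y.1 m)

/-- The family of all members of `U`. -/
def tautological : (multiplesPresheaf U hT).obj (op X) :=
  ⟨fun m => m.1.2, hT.upward (hT.maximal_mem X) fun _ f _ => ⟨f, fun _ => rfl⟩⟩

/-- The projection to a component. -/
def multiplesProj (m : U) :
    multiplesPresheaf U hT ⟶ (linearYoneda k a).obj (representative m.1.1) where
  app B := ModuleCat.ofHom (LinearMap.proj m ∘ₗ (locallyMultiples U hT B.unop).subtype)

/-- A product of representables is a sheaf because the topology is subcanonical, and being locally a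
multiple is a local condition, so glued families satisfy it. -/
lemma isSheaf_multiplesPresheaf (hsub : IsSubcanonical T) : IsSheaf T (multiplesPresheaf U hT) := by
  rw [isSheaf_iff]
  refine ⟨⟨⟨fun {Y Z f g} => ?_⟩, fun Y Z r f => ?_⟩, fun A R hR => ⟨fun x hx => ?_, fun ψ => ?_⟩⟩
  · ext y
    exact Subtype.ext (funext fun m => Preadditive.add_comp _ _ _ f.unop g.unop (y.1 m))
  · ext y
    exact Subtype.ext (funext fun m => Linear.smul_comp _ _ _ r f (y.1 m))
  · refine Subtype.ext (funext fun m => ?_)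
    refine ((isSheaf_iff.1 (hsub _)).2 A R hR).1 (x.1 m) fun B f hf => ?_
    exact congrFun (congrArg Subtype.val (hx B f hf)) m
  · choose x hx using fun m : U =>
      ((isSheaf_iff.1 (hsub _)).2 A R hR).2 (ψ ≫ multiplesProj U hT m)
    have hx' (B : a) (f : B ⟶ A) (hf : f ∈ R.arrows B) (m : U) :
        f ≫ (show A ⟶ representative m.1.1 from x m) = (ψ.app (op B) ⟨f, hf⟩).1 m := hx m B f hf
    refine ⟨⟨x, ?_⟩, fun B f hf => Subtype.ext (funext fun m => hx m B f hf)⟩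
    refine hT.local_mem _ R hR fun B f hf => hT.upward (ψ.app (op B) ⟨f, hf⟩).2 ?_
    rintro D g ⟨h, hh⟩
    exact ⟨h, fun m =>
      (Category.assoc _ _ _).trans ((congrArg (g ≫ ·) (hx' B f hf m)).trans (hh m))⟩

variable {U} in
/-- Restriction of families. -/
def restrictMultiples {U' : Set (MapsFrom X)} (h : U' ⊆ U) :
    multiplesPresheaf U hT ⟶ multiplesPresheaf U' hT where
  app B := ModuleCat.ofHom (LinearMap.restrict
    (LinearMap.pi fun m : U' => LinearMap.proj (⟨m.1, h m.2⟩ : U) :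
      (∀ m : U, B.unop ⟶ representative m.1.1) →ₗ[k] (∀ m : U', B.unop ⟶ representative m.1.1))
    fun y hy => hT.upward hy (by
      rintro D f ⟨g, hg⟩
      exact ⟨g, fun m => hg ⟨m.1, h m.2⟩⟩))

/-- The morphisms killed by finitely many members of a sieve. -/
def killed (R : LinearSieve k X)
    (s : Finset (Σ B : SmallModel.{v} a, R.arrows (representative B))) : Set (MapsFrom X) :=
  {m | ∀ j ∈ s, j.2.1 ≫ m.2 = 0}

lemma killed_antitone (R : LinearSieve k X) : Antitone (killed R) :=
  fun _ _ h _ hm j hj => hm j (h hj)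

/-- The diagram of sheaves generated by all morphisms killed by finite subsets of a sieve. -/
def killedDiagram (hsub : IsSubcanonical T) (R : LinearSieve k X) :
    Finset (Σ B : SmallModel.{v} a, R.arrows (representative B)) ⥤ Sh T where
  obj s := ⟨multiplesPresheaf (killed R s) hT, isSheaf_multiplesPresheaf _ hT hsub⟩
  map h := ObjectProperty.homMk (restrictMultiples hT (killed_antitone R (leOfHom h)))

/-- All morphisms from the members of the diagram to a sheaf vanish in the colimit. -/
lemma killedDiagram_cocone_eq_zero (hsub : IsSubcanonical T) {R : LinearSieve k X} (hR : R ∈ T X)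
    (c : Cocone (killedDiagram hT hsub R))
    (s : Finset (Σ B : SmallModel.{v} a, R.arrows (representative B))) : c.ι.app s = 0 := by
  have hF := (isSheaf_iff.1 c.pt.property).2
  have hnat (s : Finset (Σ B : SmallModel.{v} a, R.arrows (representative B))) {B D : a}
      (f : D ⟶ B) (y : (multiplesPresheaf (killed R s) hT).obj (op B)) :
      (c.ι.app s).hom.app (op D) ((multiplesPresheaf (killed R s) hT).map f.op y) =
        c.pt.obj.map f.op ((c.ι.app s).hom.app (op B) y) :=
    congrArg (fun m => m.hom y) ((c.ι.app s).hom.naturality f.op)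
  -- On `f` in `R`, pass to the stage where `f` has been added to `s`: its index family consists of
  -- morphisms killed by `f`.
  have htaut : (c.ι.app s).hom.app (op X) (tautological (killed R s) hT) = 0 := by
    refine (hF X R hR).1 _ fun B f hf => ?_
    classical
    obtain ⟨B', ⟨e⟩⟩ := exists_iso_representative B
    let j : Σ B : SmallModel.{v} a, R.arrows (representative B) :=
      ⟨B', e.inv ≫ f, R.precomp_mem e.inv f hf⟩
    have hs : s ≤ insert j s := Finset.subset_insert j s
    have h1 : ((killedDiagram hT hsub R).map (homOfLE hs)).hom.app (op B)
        ((multiplesPresheaf (killed R s) hT).map f.op (tautological (killed R s) hT)) = 0 := by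
      refine Subtype.ext (funext fun m => ?_)
      have hm : (e.inv ≫ f) ≫ m.1.2 = 0 := m.2 j (Finset.mem_insert_self j s)
      change f ≫ m.1.2 = 0
      rwa [Category.assoc, Preadditive.IsIso.comp_left_eq_zero] at hm
    rw [← hnat, ← c.w (homOfLE hs)]
    exact (congrArg ((c.ι.app (insert j s)).hom.app (op B)) h1).trans (map_zero _)
  -- Every section is locally a multiple of the tautological one, so it also goes to zero.
  ext B y
  refine (hF B.unop _ y.2).1 _ fun D f hf => ?_
  obtain ⟨h, hh⟩ := hf
  refine (hnat s f y).symm.trans ?_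
  have h1 : (multiplesPresheaf (killed R s) hT).map f.op y =
      (multiplesPresheaf (killed R s) hT).map h.op (tautological (killed R s) hT) :=
    Subtype.ext (funext fun m => hh m)
  rw [h1, hnat, htaut, map_zero]

/-- The zero cocone on `killedDiagram`. -/
def killedCocone (hsub : IsSubcanonical T) (R : LinearSieve k X) :
    Cocone (killedDiagram hT hsub R) where
  -- Families over the empty index set form the zero sheaf.
  pt := ⟨multiplesPresheaf (∅ : Set (MapsFrom X)) hT, isSheaf_multiplesPresheaf _ hT hsub⟩
  ι :=
    { app _ := 0
      naturality _ _ _ := comp_zero.trans zero_comp.symm }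

lemma multiplesPresheaf_empty_hom_ext (hsub : IsSubcanonical T) {F : Sh T}
    (f g : (⟨multiplesPresheaf (∅ : Set (MapsFrom X)) hT,
      isSheaf_multiplesPresheaf _ hT hsub⟩ : Sh T) ⟶ F) : f = g := by
  ext B y
  have : y = 0 := Subtype.ext (funext fun m => m.2.elim)
  rw [this]
  exact (map_zero _).trans (map_zero _).symm

/-- The colimit of `killedDiagram` vanishes. -/
def isColimitKilledCocone (hsub : IsSubcanonical T) {R : LinearSieve k X} (hR : R ∈ T X) :
    IsColimit (killedCocone hT hsub R) where
  desc _ := 0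
  fac c s := zero_comp.trans (killedDiagram_cocone_eq_zero hT hsub hR c s).symm
  uniq _ _ _ := multiplesPresheaf_empty_hom_ext hT hsub _ _

/-- A covering sieve of a subcanonical noetherian topology contains a finite family which is
jointly epimorphic. -/
theorem exists_finset_jointly_epi (hT : IsTopology T) (hsub : IsSubcanonical T) (hnoe : IsNoetherian T)
    {R : LinearSieve k X} (hR : R ∈ T X) :
    ∃ s : Finset (Σ B : SmallModel.{v} a, R.arrows (representative B)),
      ∀ (A : a) (g : X ⟶ A), (∀ j ∈ s, j.2.1 ≫ g = 0) → g = 0 := by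
  obtain ⟨Z, ⟨hZ⟩, _⟩ := hnoe X
  let D := killedDiagram hT hsub R
  let t : (linearYoneda k a).obj X ⟶ (D.obj ∅).obj :=
    (D.obj ∅).property.1.homOfElement (tautological (killed R ∅) hT)
  -- The transposes of the tautological section and of zero agree in the zero colimit, hence at a
  -- finite stage; there every morphism to a representative killed by `s` is zero.
  obtain ⟨s, p, q, h⟩ := IsFinitelyPresentable.exists_eq_of_isColimit
    (isColimitKilledCocone hT hsub hR) (hZ.homEquiv.symm t)
    (hZ.homEquiv.symm (0 : (linearYoneda k a).obj X ⟶ (D.obj ∅).obj))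
    (comp_zero.trans comp_zero.symm)
  have h1 := congrArg hZ.homEquiv h
  rw [hZ.homEquiv_comp, hZ.homEquiv_comp, Equiv.apply_symm_apply, Equiv.apply_symm_apply] at h1
  have h2 : tautological (killed R s) hT = 0 := by
    have h3 := congrArg (fun m : (linearYoneda k a).obj X ⟶ (D.obj s).obj =>
      m.app (op X) (𝟙 X)) h1
    refine Eq.trans ?_ h3
    exact Subtype.ext (funext fun m => (Category.id_comp m.1.2).symm)
  refine ⟨s, fun A g hg => ?_⟩
  obtain ⟨A', ⟨e⟩⟩ := exists_iso_representative A
  have h3 : g ≫ e.hom = 0 := congrFun (congrArg Subtype.val h2)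
    ⟨⟨A', g ≫ e.hom⟩, fun j hj => by rw [← Category.assoc, hg j hj, zero_comp]⟩
  rwa [Preadditive.IsIso.comp_right_eq_zero] at h3

end

end Topologies

/-! ### The equivalences and the canonical noetherian topology. -/

namespace IsEmbeddingGenerator

variable {C : Type u} [Category.{v} C] [Abelian C] [IsGrothendieckAbelian.{v} C]
  {P : ObjectProperty C} (hP : IsEmbeddingGenerator P)
  [EssentiallySmall.{v} P.FullSubcategory] [HasFiniteBiproducts P.FullSubcategory]
  {k : Type w} [CommRing k] [Linear k C]
include hP

theorem exists_equivalence {Q : ObjectProperty (P.FullSubcategoryᵒᵖ ⥤ ModuleCat.{v} k)}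
    (hQ : Q = SendsCokernelsToKernels k P.FullSubcategory) :
    ∃ e : C ≌ Q.FullSubcategory, e.functor.Additive ∧ e.functor.Linear k ∧
      Nonempty (e.functor ⋙ Q.ι ≅ restrictedYoneda k P) := by
  subst hQ
  let Q := SendsCokernelsToKernels k P.FullSubcategory
  let G : C ⥤ Q.FullSubcategory := Q.lift (restrictedYoneda k P) fun M =>
    sendsCokernelsToKernels_iff.2 ⟨isLinearPresheaf_restrictedYoneda M,
      hP.descendsAlongCokernels_restrictedYoneda M⟩
  have := hP.faithful_restrictedYoneda (k := k)
  have := hP.full_restrictedYoneda (k := k)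
  have hess : G.EssSurj := ⟨fun F => by
    obtain ⟨h1, h2⟩ := sendsCokernelsToKernels_iff.1 F.property
    obtain ⟨M, ⟨e⟩⟩ := hP.mem_essImage_restrictedYoneda h1 h2
    exact ⟨M, ⟨Q.isoMk e⟩⟩⟩
  have hfull : G.Full := inferInstanceAs (Q.lift (restrictedYoneda k P) _).Full
  have hfaithful : G.Faithful := inferInstanceAs (Q.lift (restrictedYoneda k P) _).Faithful
  have hG : G.IsEquivalence := {}
  refine ⟨G.asEquivalence, ⟨fun {M N f g} => ?_⟩, ⟨fun {M N} f r => ?_⟩, ⟨Iso.refl _⟩⟩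
  · ext1
    exact (restrictedYoneda k P).map_add
  · ext1
    exact (restrictedYoneda k P).map_smul r f

lemma isSubcanonical_top : IsSubcanonical (top k (rightExactSeqs P.FullSubcategory)) := fun X =>
  hP.isSheaf_top_iff.2 ⟨isLinearPresheaf_linearYoneda X, descendsAlongCokernels_linearYoneda X⟩

/-- A representable is a sheaf, hence its own sheafification, and it corresponds to the compact
object `X` of `C` under the equivalence. -/
lemma isNoetherian_top : IsNoetherian (top k (rightExactSeqs P.FullSubcategory)) := by
  intro X
  let Z : Sh (top k (rightExactSeqs P.FullSubcategory)) :=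
    ⟨(linearYoneda k P.FullSubcategory).obj X, hP.isSubcanonical_top X⟩
  refine ⟨Z, ⟨{ homEquiv := ⟨fun f => f.hom, fun f => ObjectProperty.homMk f, fun _ => rfl,
    fun _ => rfl⟩, homEquiv_comp := fun _ _ => rfl }⟩, ?_⟩
  obtain ⟨e, _, _, ⟨i⟩⟩ := hP.exists_equivalence (k := k) hP.isSheaf_top_eq
  have := hP.compact _ X.property
  have : Fact (Cardinal.aleph0.{v}).IsRegular := Cardinal.fact_isRegular_aleph0
  let i' : (restrictedYoneda k P).obj X.obj ≅ (linearYoneda k P.FullSubcategory).obj X :=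
    NatIso.ofComponents fun B => LinearEquiv.toModuleIso
      { toFun f := (ObjectProperty.homMk f : B.unop ⟶ X)
        invFun f := f.hom
        map_add' _ _ := rfl
        map_smul' _ _ := rfl
        left_inv _ := rfl
        right_inv _ := rfl }
  have hcomp : IsCardinalPresentable (e.functor.obj X.obj) Cardinal.aleph0.{v} :=
    isCardinalPresentable_of_equivalence X.obj Cardinal.aleph0.{v} e
  exact isCardinalPresentable_of_iso
    ((IsSheaf (top k (rightExactSeqs P.FullSubcategory))).isoMk (i.app X.obj ≪≫ i')) _

theorem isCanonicalNoetherian_top :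
    IsCanonicalNoetherian (top k (rightExactSeqs P.FullSubcategory)) := by
  refine ⟨⟨hP.isTopology_top, hP.isSubcanonical_top, hP.isNoetherian_top⟩, ?_⟩
  rintro T ⟨hT, hsub, hnoe⟩ X R hR
  obtain ⟨s, hs⟩ := exists_finset_jointly_epi hT hsub hnoe hR
  -- A linear sieve is closed under sums, so this combination of the members of `s` stays in `R`;
  -- joint epimorphy and `epi_hom` make it an epimorphism of `C`.
  let q : (⨁ fun j : s => representative j.1.1) ⟶ X :=
    ∑ j : s, biproduct.π (fun j : s => representative j.1.1) j ≫ j.1.2.1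
  have hq {j} (hj : j ∈ s) :
      biproduct.ι (fun j : s => representative j.1.1) ⟨j, hj⟩ ≫ q = j.2.1 := by
    rw [Preadditive.comp_sum, Finset.sum_eq_single ⟨j, hj⟩]
    · simp
    · intro i _ hi
      rw [biproduct.ι_π_ne_assoc _ hi.symm, zero_comp]
    · exact fun h => (h (Finset.mem_univ _)).elim
  refine hP.mem_top_iff.2 ⟨_, q, hP.epi_hom _ fun A g hg => hs A g fun j hj => ?_,
    Submodule.sum_mem _ fun j _ => R.precomp_mem _ _ j.1.2.2⟩
  rw [← hq hj, Category.assoc, hg, comp_zero]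

end IsEmbeddingGenerator

end LinearTop

end

theorem mainTheorem9 (k : Type w) [CommRing k] (C : Type u) [Category.{v} C] [Abelian C]
    [Linear k C] [IsGrothendieckAbelian.{v} C] (P : ObjectProperty C)
    [EssentiallySmall.{v} P.FullSubcategory] [HasFiniteBiproducts P.FullSubcategory]
    (generator : P.IsSeparating)
    (compact : ∀ A : C, P A → IsFinitelyPresentable.{v} A)
    (subobject : ∀ V : C, IsFinitelyPresentable.{v} V → ∃ (A : C) (i : V ⟶ A), P A ∧ Mono i) :
    LinearTop.IsPretopology (LinearTop.rightExactSeqs P.FullSubcategory) ∧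
    LinearTop.IsCanonicalNoetherian
      (LinearTop.top k (LinearTop.rightExactSeqs P.FullSubcategory)) ∧
    (∃ e : C ≌ LinearTop.Sh (LinearTop.top k (LinearTop.rightExactSeqs P.FullSubcategory)),
      e.functor.Additive ∧ e.functor.Linear k ∧
      Nonempty (e.functor ⋙ ObjectProperty.ι _ ≅ LinearTop.restrictedYoneda k P)) ∧
    (∃ e : C ≌ (LinearTop.SendsCokernelsToKernels k P.FullSubcategory).FullSubcategory,
      e.functor.Additive ∧ e.functor.Linear k ∧
      Nonempty (e.functor ⋙ ObjectProperty.ι _ ≅ LinearTop.restrictedYoneda k P)) :=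
  have hP : LinearTop.IsEmbeddingGenerator P := ⟨generator, compact, subobject⟩
  ⟨hP.isPretopology, hP.isCanonicalNoetherian_top, hP.exists_equivalence hP.isSheaf_top_eq,
    hP.exists_equivalence rfl⟩
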